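/- Let $m\ge 1$ be a squarefree integer, $\mathbb{K}=\mathbb{Q}(\sqrt{-m})\subset\mathbb{C}$ with discriminant $d_{\mathbb{K}}$ and ring of integers $\mathcal{O}$, and let $r\in\mathbb{Z}$. Let $\mathbb{H}_2=\{Z\in\mathbb{C}^{2\times2}:\frac1{2i}(Z-\overline{Z}^{tr})>0\}$ be the Hermitian half space, let $J=\begin{pmatrix}0&-I\\ I&0\end{pmatrix}$, and let $SU(2,2;\mathbb{C})=\{M\in SL_4(\mathbb{C}):\overline{M}^{tr}JM=J\}$ act on $\mathbb{H}_2$ by $M\langle Z\rangle=(AZ+B)(CZ+D)^{-1}$ for $M=\begin{pmatrix}A&B\\ C&D\end{pmatrix}$. Let $\Gamma_2=SU(2,2;\mathbb{C})\cap\mathcal{O}^{4\times4}$ be the Hermitian modular group and $$\Delta^*_{2,\mathbb{K}}=\bigcup_{A\in\mathcal{A}}\begin{pmatrix}A&0\\0&(\overline{A}^{tr})^{-1}\end{pmatrix}\Gamma_2$$ the extended Hermitian modular group, where $\mathcal{A}$ is the set of all $A=\frac1uL\in SL_2(\mathbb{C})$ with $u\in\mathbb{C}$ and $L\in\mathcal{O}^{2\times2}$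 such that the ideal $\mathcal{I}(L)$ generated by the entries of $L$ satisfies $\mathcal{I}(L)^2=\mathcal{O}\det L$. For $G\in\{\Gamma_2,\Delta^*_{2,\mathbb{K}}\}$ let $[G,r]$ be the space of all holomorphic $f:\mathbb{H}_2\to\mathbb{C}$ with $f(M\langle Z\rangle)=\det(CZ+D)^{r}f(Z)$ for all $M\in G$, $Z\in\mathbb{H}_2$. Let $\Lambda$ be the set of all Hermitian matrices $T=\begin{pmatrix}k&t\\ \overline{t}&l\end{pmatrix}$ with $k,l\in\mathbb{Z}$ and $t\in\frac{1}{\sqrt{d_{\mathbb{K}}}}\mathcal{O}$; for $0\ne T\in\Lambda$ let $\varepsilon(T)=\max\{q\in\mathbb{N}:\frac1qT\in\Lambda\}$. For $f\in[\Gamma_2,r]$ let $\alpha_f(T)$, $T\in\Lambda$, be the Fourier coefficients of $f$, that is, $$\alpha_f(T)=\int f(X+iI)\,e^{-2\pi i\,\mathrm{tr}(T(X+iI))}\,dX,$$ where $X$ runs through the Hermitian matrices modulo those with entries in $\mathcal{O}$, with total volume $1$. (Thus $f(Z)=\sum_{T\in\Lambda,\,T\ge0}\alpha_f(T)e^{2\pi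 i\,\mathrm{tr}(TZ)}$.) Sugano's Maaß space $\mathcal{S}(r,\mathcal{O})$ is the set of all $f\in[\Gamma_2,r]$ with $$\alpha_f(T)=\sum_{\eta\mid\varepsilon(T)}\eta^{r-1}\,\alpha_f\begin{pmatrix}1&t/\eta\\ \overline{t}/\eta&kl/\eta^2\end{pmatrix}\quad\text{for all }T=\begin{pmatrix}k&t\\ \overline{t}&l\end{pmatrix}\in\Lambda,\ T\ge0,\ T\ne0,$$ and Krieg's Maaß space $\mathcal{M}(r,\mathcal{O})$ is the set of all $f\in[\Gamma_2,r]$ for which there is a function $\alpha_f^*:\mathbb{N}_0\to\mathbb{C}$ with $$\alpha_f(T)=\sum_{\eta\mid\varepsilon(T)}\eta^{r-1}\,\alpha_f^*\!\left(-d_{\mathbb{K}}\det(T)/\eta^2\right)\quad\text{for all }T\in\Lambda,\ T\ge0,\ T\ne0,$$ the sums running over the positive divisors $\eta$ of $\varepsilon(T)$. **Theorem.** Let $f\in\mathcal{S}(r,\mathcal{O})$. Then $f\in\mathcal{M}(r,\mathcal{O})$ if and only if $f\in[\Delta^*_{2,\mathbb{K}},r]$. -/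

import Mathlib

noncomputable section

namespace HermitianMaass

open scoped ComplexOrder
open Matrix MeasureTheory

/-- The square root `√(-m) = i √m` in the upper half plane. -/
def sqrtNeg (m : ℕ) : ℂ := Complex.I * (Real.sqrt m : ℂ)

/-- The discriminant of `ℚ(√-m)`, for squarefree `m`. -/
def disc (m : ℕ) : ℤ := if m % 4 = 3 then -(m : ℤ) else -4 * (m : ℤ)

/-- The generator `ω` of the ring of integers of `ℚ(√-m)` over `ℤ`. -/
def omega (m : ℕ) : ℂ := if m % 4 = 3 then (1 + sqrtNeg m) / 2 else sqrtNeg m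

theorem sqrtNeg_mul_self (m : ℕ) : sqrtNeg m * sqrtNeg m = -(m : ℂ) := by
  have h : (Real.sqrt m : ℂ) * (Real.sqrt m : ℂ) = (m : ℂ) := by
    rw [← Complex.ofReal_mul, Real.mul_self_sqrt (Nat.cast_nonneg m)]
    simp
  unfold sqrtNeg
  linear_combination (Complex.I * Complex.I) * h + (m : ℂ) * Complex.I_mul_I

theorem omega_mul_self (m : ℕ) : ∃ a b : ℤ, omega m * omega m = a + b * omega m := by
  have h := sqrtNeg_mul_self m
  unfold omega
  split_ifs with hm
  · obtain ⟨k, hk⟩ : ∃ k : ℕ, m = 4 * k + 3 := ⟨m / 4, by omega⟩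
    have h4 : (m : ℂ) = 4 * (k : ℂ) + 3 := by exact_mod_cast hk
    refine ⟨-(k : ℤ) - 1, 1, ?_⟩
    push_cast
    linear_combination (1 / 4) * h - (1 / 4) * h4
  · exact ⟨-(m : ℤ), 0, by push_cast; linear_combination h⟩

/-- The ring of integers `ℤ + ℤ ω` of `ℚ(√-m)`, as a subring of `ℂ`. -/
def ringInt (m : ℕ) : Subring ℂ where
  carrier := {z | ∃ a b : ℤ, z = a + b * omega m}
  zero_mem' := ⟨0, 0, by simp⟩
  one_mem' := ⟨1, 0, by simp⟩
  add_mem' := by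
    rintro _ _ ⟨a, b, rfl⟩ ⟨c, d, rfl⟩
    exact ⟨a + c, b + d, by push_cast; ring⟩
  neg_mem' := by
    rintro _ ⟨a, b, rfl⟩
    exact ⟨-a, -b, by push_cast; ring⟩
  mul_mem' := by
    rintro _ _ ⟨a, b, rfl⟩ ⟨c, d, rfl⟩
    obtain ⟨s, t, h⟩ := omega_mul_self m
    refine ⟨a * c + b * d * s, a * d + b * c + b * d * t, ?_⟩
    push_cast
    linear_combination ((b : ℂ) * d) * h

/-- The square root of the discriminant, `i √|d|`. -/
def sqrtDisc (m : ℕ) : ℂ := Complex.I * (Real.sqrt (-(disc m : ℝ)) : ℂ)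

/-- The inverse different `(1 / √d) 𝒪`. -/
def dualInt (m : ℕ) : Set ℂ := {z | ∃ w ∈ ringInt m, z = (sqrtDisc m)⁻¹ * w}

/-- The Hermitian half space of degree two. -/
def halfSpace : Set (Matrix (Fin 2) (Fin 2) ℂ) :=
  {Z | ((1 / (2 * Complex.I)) • (Z - Zᴴ)).PosDef}

/-- The special unitary group `SU(2,2;ℂ)`; `Matrix.J` is the block matrix `(0, -I; I, 0)`. -/
def specialUnitary : Set (Matrix (Fin 2 ⊕ Fin 2) (Fin 2 ⊕ Fin 2) ℂ) :=
  {M | M.det = 1 ∧ Mᴴ * Matrix.J (Fin 2) ℂ * M = Matrix.J (Fin 2) ℂ}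

/-- The matrix `C Z + D`, for `M = (A, B; C, D)`. -/
def denom (M : Matrix (Fin 2 ⊕ Fin 2) (Fin 2 ⊕ Fin 2) ℂ) (Z : Matrix (Fin 2) (Fin 2) ℂ) :
    Matrix (Fin 2) (Fin 2) ℂ :=
  M.toBlocks₂₁ * Z + M.toBlocks₂₂

/-- The action `M⟨Z⟩ = (A Z + B) (C Z + D)⁻¹`, for `M = (A, B; C, D)`. -/
def act (M : Matrix (Fin 2 ⊕ Fin 2) (Fin 2 ⊕ Fin 2) ℂ) (Z : Matrix (Fin 2) (Fin 2) ℂ) :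
    Matrix (Fin 2) (Fin 2) ℂ :=
  (M.toBlocks₁₁ * Z + M.toBlocks₁₂) * (denom M Z)⁻¹

/-- The Hermitian modular group `Γ₂(𝒪)`. -/
def modularGroup (m : ℕ) : Set (Matrix (Fin 2 ⊕ Fin 2) (Fin 2 ⊕ Fin 2) ℂ) :=
  {M | M ∈ specialUnitary ∧ ∀ i j, M i j ∈ ringInt m}

/-- The ideal generated by the entries of an integral matrix. -/
def entryIdeal {m : ℕ} (L : Matrix (Fin 2) (Fin 2) (ringInt m)) : Ideal (ringInt m) :=
  Ideal.span {x | ∃ i j, x = L i j}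

/-- The set of all `A = (1 / u) L ∈ SL₂(ℂ)` with `u ∈ ℂ`, `L` integral and
`I(L)² = 𝒪 det L`. -/
def extensionMatrices (m : ℕ) : Set (Matrix (Fin 2) (Fin 2) ℂ) :=
  {A | A.det = 1 ∧ ∃ (u : ℂ) (L : Matrix (Fin 2) (Fin 2) (ringInt m)),
    A = (1 / u) • L.map (fun x => (x : ℂ)) ∧ entryIdeal L ^ 2 = Ideal.span {L.det}}

/-- The extended Hermitian modular group `Δ₂*`, the union of the cosets `M_A Γ₂(𝒪)`, where `M_A`
is the block diagonal matrix with blocks `A` and the inverse of the conjugate transpose of `A`. -/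
def extendedGroup (m : ℕ) : Set (Matrix (Fin 2 ⊕ Fin 2) (Fin 2 ⊕ Fin 2) ℂ) :=
  {M | ∃ A ∈ extensionMatrices m, ∃ G ∈ modularGroup m,
    M = Matrix.fromBlocks A 0 0 (Aᴴ)⁻¹ * G}

/-- The holomorphic functions on the half space with `f(M⟨Z⟩) = det(C Z + D)^r f(Z)` for all
`M` in `G`. Only the values of `f` on the half space matter. -/
def modularForms (G : Set (Matrix (Fin 2 ⊕ Fin 2) (Fin 2 ⊕ Fin 2) ℂ)) (r : ℤ) :
    Set (Matrix (Fin 2) (Fin 2) ℂ → ℂ) :=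
  {f | DifferentiableOn ℂ f halfSpace ∧
    ∀ M ∈ G, ∀ Z ∈ halfSpace, f (act M Z) = (denom M Z).det ^ r * f Z}

/-- The lattice `Λ(2,𝒪)` of Hermitian matrices with integral diagonal and off-diagonal entries in
the inverse different. -/
def fourierLattice (m : ℕ) : Set (Matrix (Fin 2) (Fin 2) ℂ) :=
  {T | Tᴴ = T ∧ (∀ i, ∃ k : ℤ, T i i = k) ∧ ∀ i j, i ≠ j → T i j ∈ dualInt m}

/-- The Hermitian matrix with coordinates `x` with respect to the `ℤ`-basis of the Hermitian
matrices over `𝒪` that is given by `1` on either diagonal place and by `1` and `ω` off the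
diagonal. -/
def hermCoord (m : ℕ) (x : Fin 4 → ℝ) : Matrix (Fin 2) (Fin 2) ℂ :=
  !![(x 0 : ℂ), x 1 + x 2 * omega m; star (x 1 + x 2 * omega m : ℂ), (x 3 : ℂ)]

/-- The Fourier coefficient `α_f(T)`, the integral of `f(Z) exp(-2πi tr(T Z))` over `Z = X + i I`,
where `X` runs through the Hermitian matrices modulo those over `𝒪`, normalized to volume one. -/
def fourierCoefficient (m : ℕ) (f : Matrix (Fin 2) (Fin 2) ℂ → ℂ)
    (T : Matrix (Fin 2) (Fin 2) ℂ) : ℂ :=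
  ∫ x in Set.Icc (0 : Fin 4 → ℝ) 1,
    f (hermCoord m x + Complex.I • (1 : Matrix (Fin 2) (Fin 2) ℂ)) *
      Complex.exp (-(2 * Real.pi * Complex.I *
        (T * (hermCoord m x + Complex.I • (1 : Matrix (Fin 2) (Fin 2) ℂ))).trace))

/-- The content `ε(T)`, the largest natural number `q` with `(1 / q) T ∈ Λ(2,𝒪)`, for nonzero
`T` in `Λ(2,𝒪)`. -/
def content (m : ℕ) (T : Matrix (Fin 2) (Fin 2) ℂ) : ℕ :=
  sSup {q : ℕ | 0 < q ∧ (1 / (q : ℂ)) • T ∈ fourierLattice m}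

/-- Sugano's Maaß space. -/
def suganoSpace (m : ℕ) (r : ℤ) : Set (Matrix (Fin 2) (Fin 2) ℂ → ℂ) :=
  {f | f ∈ modularForms (modularGroup m) r ∧
    ∀ T ∈ fourierLattice m, T.PosSemidef → T ≠ 0 →
      fourierCoefficient m f T = ∑ η ∈ (content m T).divisors,
        (η : ℂ) ^ (r - 1) * fourierCoefficient m f
          !![1, T 0 1 / η; T 1 0 / η, T 1 1 * T 0 0 / (η : ℂ) ^ 2]}

/-- The number `-d det(T) / η²`. It is a natural number if `T ≥ 0` and `(1 / η) T ∈ Λ(2,𝒪)`, as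
`natDet_eq` shows, so that the floor has no effect then. -/
def natDet (m : ℕ) (T : Matrix (Fin 2) (Fin 2) ℂ) (η : ℕ) : ℕ :=
  ⌊-(disc m : ℝ) * T.det.re / (η : ℝ) ^ 2⌋₊

theorem star_omega (m : ℕ) : ∃ a b : ℤ, star (omega m) = a + b * omega m := by
  have h : star (sqrtNeg m) = -sqrtNeg m := by simp [sqrtNeg]
  unfold omega
  split_ifs with hm
  · refine ⟨1, -1, ?_⟩
    rw [star_div₀, star_add, h]
    simp
    ring
  · exact ⟨0, -1, by rw [h]; simp⟩

theorem star_mem_ringInt {m : ℕ} {w : ℂ} (hw : w ∈ ringInt m) : star w ∈ ringInt m := by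
  obtain ⟨a, b, rfl⟩ := hw
  obtain ⟨c, d, h⟩ := star_omega m
  refine ⟨a + b * c, b * d, ?_⟩
  rw [star_add, star_mul', h]
  simp
  ring

theorem exists_int_of_mem_ringInt {m : ℕ} {w : ℂ} (hw : w ∈ ringInt m) (him : w.im = 0) :
    ∃ n : ℤ, w = n := by
  obtain ⟨a, b, rfl⟩ := hw
  by_cases hb : (b : ℝ) * (omega m).im = 0
  · rcases mul_eq_zero.mp hb with hb | hb
    · exact ⟨a, by simp [Int.cast_eq_zero.mp hb]⟩
    · have hs : Real.sqrt m = 0 := by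
        unfold omega at hb
        split_ifs at hb <;> simpa [sqrtNeg] using hb
      have hm : m = 0 := by
        have := (Real.sqrt_eq_zero (Nat.cast_nonneg m)).mp hs
        exact_mod_cast this
      subst hm
      exact ⟨a, by simp [omega, sqrtNeg]⟩
  · exact absurd (by simpa using him) hb

theorem natDet_eq {m : ℕ} {T : Matrix (Fin 2) (Fin 2) ℂ} {η : ℕ} (hη : 0 < η)
    (hT : T.PosSemidef) (h : (1 / (η : ℂ)) • T ∈ fourierLattice m) :
    (natDet m T η : ℂ) = -(disc m : ℂ) * T.det / (η : ℂ) ^ 2 := by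
  have hη0 : (η : ℂ) ≠ 0 := by exact_mod_cast hη.ne'
  have hd : 0 ≤ -(disc m : ℝ) := by
    unfold disc
    split_ifs <;> simp
  have hdet : (0 : ℂ) ≤ T.det := hT.det_nonneg
  obtain ⟨hre, him⟩ := Complex.nonneg_iff.mp hdet
  have hTre : T.det = (T.det.re : ℂ) := by
    apply Complex.ext <;> simp [← him]
  obtain ⟨h1, h2, h3⟩ := h
  obtain ⟨k, hk⟩ := h2 0
  obtain ⟨l, hl⟩ := h2 1
  obtain ⟨w, hw, ht⟩ := h3 0 1 (by decide)
  have ht' : ((1 / (η : ℂ)) • T) 1 0 = star (((1 / (η : ℂ)) • T) 0 1) := by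
    conv_lhs => rw [← h1]
    rfl
  rw [ht] at ht'
  have hsq : sqrtDisc m * star (sqrtDisc m) = -(disc m : ℂ) := by
    have : (Real.sqrt (-(disc m : ℝ)) : ℂ) * (Real.sqrt (-(disc m : ℝ)) : ℂ)
        = -(disc m : ℂ) := by
      rw [← Complex.ofReal_mul, Real.mul_self_sqrt hd]
      simp
    simp only [sqrtDisc, star_mul', Complex.star_def, Complex.conj_I, Complex.conj_ofReal]
    linear_combination this - (Real.sqrt (-(disc m : ℝ)) : ℂ) ^ 2 * Complex.I_mul_I
  simp only [Matrix.smul_apply, smul_eq_mul] at hk hl ht ht'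
  -- the product of the off-diagonal entries, times `-d`, is `w * star w`
  have hprod : ∃ n : ℤ, -(disc m : ℂ) * T.det / (η : ℂ) ^ 2 = n := by
    obtain ⟨n, hn⟩ := exists_int_of_mem_ringInt
      ((ringInt m).mul_mem hw (star_mem_ringInt hw)) (by simp [Complex.mul_im]; ring)
    have e : -(disc m : ℂ) * T.det / (η : ℂ) ^ 2
        = -(disc m : ℂ) * ((1 / (η : ℂ) * T 0 0) * (1 / (η : ℂ) * T 1 1)
          - (1 / (η : ℂ) * T 0 1) * (1 / (η : ℂ) * T 1 0)) := by
      rw [Matrix.det_fin_two]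
      field_simp
    rw [e, hk, hl, ht, ht']
    by_cases h0 : sqrtDisc m = 0
    · refine ⟨0, ?_⟩
      rw [← hsq, h0]
      simp
    · refine ⟨-disc m * (k * l) - n, ?_⟩
      have h0' : star (sqrtDisc m) ≠ 0 := by simpa using h0
      have e2 : -(disc m : ℂ) * ((sqrtDisc m)⁻¹ * w * star ((sqrtDisc m)⁻¹ * w)) = n := by
        rw [← hsq, star_mul', star_inv₀, ← hn]
        field_simp
      push_cast
      linear_combination -e2
  obtain ⟨n, hn⟩ := hprod
  have hnR : -(disc m : ℝ) * T.det.re / (η : ℝ) ^ 2 = n := by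
    rw [hTre] at hn
    exact_mod_cast hn
  have hn0 : 0 ≤ n := by
    have : (0 : ℝ) ≤ n := by rw [← hnR]; positivity
    exact_mod_cast this
  rw [hn, natDet, hnR]
  lift n to ℕ using hn0
  simp

/-- Krieg's Maaß space. -/
def kriegSpace (m : ℕ) (r : ℤ) : Set (Matrix (Fin 2) (Fin 2) ℂ → ℂ) :=
  {f | f ∈ modularForms (modularGroup m) r ∧
    ∃ a : ℕ → ℂ, ∀ T ∈ fourierLattice m, T.PosSemidef → T ≠ 0 →
      fourierCoefficient m f T = ∑ η ∈ (content m T).divisors,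
        (η : ℂ) ^ (r - 1) * a (natDet m T η)}

end HermitianMaass

end

noncomputable section

namespace HermitianMaass

open scoped ComplexOrder
open Matrix MeasureTheory

/-! ### Holomorphic parameter integrals -/

/-! Because $\Delta^*_{2,\mathbb{K}}$ is a union of cosets $M_A\Gamma_2$, a form on $\Gamma_2$ is a
form on the extended group exactly when $f(AZ\overline{A}^{tr})=f(Z)$ for all $A\in\mathcal{A}$. The
entries of such an $A$ need not lie in $\mathbb{K}$, but the products $A_{ij}\overline{A_{kl}}$ lie
in $\mathcal{O}$ (`isAdmissible_of_mem_extensionMatrices`). Hence $T\mapsto\overline{A}^{tr}TA$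
permutes $\Lambda$ and keeps the determinant, the content and semidefiniteness. By uniqueness of
Fourier expansions the invariance becomes $\alpha_f(\overline{A}^{tr}TA)=\alpha_f(T)$ for all
$T\in\Lambda$ (`IsAdmissible.invariant_iff`).

From Krieg's relation to the extended group: for $T\ge0$, $T\ne0$ the coefficient depends only on
content and determinant, the case $T=0$ is trivial, and both coefficients vanish when $T$ is not
semidefinite, by the Koecher principle.

From the extended group to Krieg's relation: Sugano's relation leaves only the coefficients at
matrices with upper left entry $1$, and these have to depend on the determinant alone. Translations
by $\mathcal{O}$ show that such a coefficient depends on the determinant and on the class of $t$ in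
$\mathcal{O}/\sqrt{d_{\mathbb{K}}}$ modulo $\mathcal{O}$. The matrix $\overline{A}^{tr}TA$ again has
content $1$, so Sugano's relation brings it back to upper left entry $1$. The net effect on the
class of $t$ is multiplication by `multiplier A` (`fourierCoefficient_normalMatrix_eq`).

It remains to see that these multipliers connect any two classes whose norms are compatible with
equal determinants. This is arithmetic at the ramified primes: a factorization $m=qq'$ yields an $A$
acting as $-1$ modulo $q$ and as $+1$ modulo $q'$ (`exists_multiplier_of_coprime`), which settles
congruences $x^2\equiv x'^2$ modulo $m$. For $m\equiv1$ mod $4$ one more matrix, from the prime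
above $2$, is needed (`exists_multiplier_two`). -/

theorem differentiableOn_setIntegral {V : Type*} [TopologicalSpace V] [MeasurableSpace V]
    [BorelSpace V] [T2Space V] [SecondCountableTopology V] {μ : Measure V}
    [IsFiniteMeasureOnCompacts μ] {K : Set V}
    (hK : IsCompact K) {U : Set ℂ} (hU : IsOpen U) {G : ℂ → V → ℂ}
    (hc : ContinuousOn (Function.uncurry G) (U ×ˢ Set.univ))
    (hd : ∀ x, DifferentiableOn ℂ (fun s => G s x) U) :
    DifferentiableOn ℂ (fun s => ∫ x in K, G s x ∂μ) U := by
  intro s₀ hs₀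
  obtain ⟨ρ, hρ, hball⟩ := Metric.isOpen_iff.mp hU s₀ hs₀
  have hsub : Metric.closedBall s₀ (ρ / 2) ⊆ U :=
    (Metric.closedBall_subset_ball (by linarith)).trans hball
  have hcx : ∀ s ∈ U, Continuous (G s) := fun s hs => by
    have : Continuous fun x : V => (s, x) := by fun_prop
    exact hc.comp_continuous this (fun x => ⟨hs, Set.mem_univ x⟩)
  obtain ⟨C, hC⟩ := ((isCompact_closedBall s₀ (ρ / 2)).prod hK).exists_bound_of_continuousOn
    (hc.mono (Set.prod_mono hsub (Set.subset_univ K)))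
  have hmeas : ∀ s ∈ U, AEStronglyMeasurable (G s) (μ.restrict K) := fun s hs =>
    (hcx s hs).aestronglyMeasurable
  have hder : ∀ x, ∀ s ∈ U, HasDerivAt (fun s => G s x) (deriv (fun s => G s x) s) s :=
    fun x s hs => ((hd x).differentiableAt (hU.mem_nhds hs)).hasDerivAt
  have hKfin : IsFiniteMeasure (μ.restrict K) := ⟨by simpa using hK.measure_lt_top⟩
  -- A bound `C` for `G` on the ball of radius `ρ / 2` gives, by Cauchy's estimate on circles of
  -- radius `ρ / 4`, the constant majorant `C / (ρ / 4)` of the derivative.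
  have key := hasDerivAt_integral_of_dominated_loc_of_deriv_le (μ := μ.restrict K)
    (F := G) (x₀ := s₀) (s := Metric.ball s₀ (ρ / 4)) (bound := fun _ => C / (ρ / 4))
    (F' := fun s x => deriv (fun s => G s x) s)
    (Metric.ball_mem_nhds _ (by linarith))
    (by filter_upwards [hU.mem_nhds hs₀] with s hs using hmeas s hs)
    ((hcx s₀ hs₀).continuousOn.integrableOn_compact hK)
    ?_ ?_ (integrable_const _) ?_
  · exact key.2.differentiableAt.differentiableWithinAt
  -- The derivative is measurable in `x` as a pointwise limit of difference quotients; the steps `u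
  -- n` are small enough to stay in the closed ball.
  · let u : ℕ → ℂ := fun n => ((ρ / 2 / (n + 1) : ℝ) : ℂ)
    have hu0 : Filter.Tendsto u Filter.atTop (nhds 0) := by
      have h1 : Filter.Tendsto (fun n : ℕ => ρ / 2 / ((n : ℝ) + 1)) Filter.atTop (nhds 0) :=
        tendsto_const_nhds.div_atTop
          (Filter.tendsto_atTop_add_const_right _ _ tendsto_natCast_atTop_atTop)
      have h2 := (Complex.continuous_ofReal.tendsto _).comp h1
      rw [Complex.ofReal_zero] at h2
      exact h2
    have hune : ∀ n, u n ≠ 0 := fun n => by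
      have : ρ / 2 / ((n : ℝ) + 1) ≠ 0 := by positivity
      exact Complex.ofReal_ne_zero.mpr this
    have hu : Filter.Tendsto u Filter.atTop (nhdsWithin 0 {0}ᶜ) :=
      tendsto_nhdsWithin_iff.mpr ⟨hu0, Filter.Eventually.of_forall hune⟩
    have huU : ∀ n, s₀ + u n ∈ U := fun n => hsub (by
      have h0 : (0 : ℝ) < n + 1 := by positivity
      have : ‖u n‖ ≤ ρ / 2 := by
        rw [Complex.norm_real, Real.norm_of_nonneg (by positivity)]
        exact div_le_self (by positivity) (by linarith [(Nat.cast_nonneg n : (0 : ℝ) ≤ n)])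
      simpa [Metric.mem_closedBall, dist_eq_norm] using this)
    refine aestronglyMeasurable_of_tendsto_ae Filter.atTop
      (f := fun n x => (u n)⁻¹ • (G (s₀ + u n) x - G s₀ x)) (fun n => ?_) ?_
    · exact AEStronglyMeasurable.const_smul (f := fun x => G (s₀ + u n) x - G s₀ x)
        ((hmeas _ (huU n)).sub (hmeas _ hs₀)) (u n)⁻¹
    · exact Filter.Eventually.of_forall fun x =>
        (hasDerivAt_iff_tendsto_slope_zero.mp (hder x s₀ hs₀)).comp hu
  · refine (ae_restrict_iff' hK.measurableSet).mpr (Filter.Eventually.of_forall fun x hx s hs => ?_)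
    have hcb : Metric.closedBall s (ρ / 4) ⊆ Metric.closedBall s₀ (ρ / 2) :=
      Metric.closedBall_subset_closedBall' (by linarith [Metric.mem_ball.mp hs])
    refine Complex.norm_deriv_le_of_forall_mem_sphere_norm_le (by linarith) ?_ fun z hz => ?_
    · refine DifferentiableOn.diffContOnCl_ball (U := U) (hd x) (hcb.trans hsub)
    · exact hC (z, x) ⟨hcb (Metric.sphere_subset_closedBall hz), hx⟩
  · exact Filter.Eventually.of_forall fun x s hs => hder x s
      (hsub (Metric.ball_subset_closedBall (Metric.ball_subset_ball (by linarith) hs)))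

/-! ### Periodic functions on `ℝᵈ` and the torus -/

section Periodic

local instance : MeasureSpace UnitAddCircle := ⟨AddCircle.haarAddCircle⟩

local instance : Measure.IsAddHaarMeasure (volume : Measure UnitAddCircle) :=
  inferInstanceAs (Measure.IsAddHaarMeasure AddCircle.haarAddCircle)

local instance : IsProbabilityMeasure (volume : Measure UnitAddCircle) :=
  inferInstanceAs (IsProbabilityMeasure AddCircle.haarAddCircle)

variable {d : Type*}

/-- The projection `ℝᵈ → (ℝ/ℤ)ᵈ`. -/
def toTorus (x : d → ℝ) : UnitAddTorus d := fun i => (x i : UnitAddCircle)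

theorem isOpenQuotientMap_toTorus : IsOpenQuotientMap (toTorus (d := d)) :=
  IsOpenQuotientMap.piMap (fun _ : d => QuotientAddGroup.isOpenQuotientMap_mk)

theorem toTorus_eq_iff {x y : d → ℝ} :
    toTorus x = toTorus y ↔ ∃ n : d → ℤ, y = x + fun i => (n i : ℝ) := by
  constructor
  · intro h
    have : ∀ i, ∃ n : ℤ, y i = x i + n := fun i => by
      have hi : (x i : UnitAddCircle) = (y i : UnitAddCircle) := congrFun h i
      rw [QuotientAddGroup.eq] at hi
      obtain ⟨n, hn⟩ := AddSubgroup.mem_zmultiples_iff.mp hi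
      exact ⟨n, by simp at hn; linarith⟩
    choose n hn using this
    exact ⟨n, funext hn⟩
  · rintro ⟨n, rfl⟩
    funext i
    simp [toTorus]

/-- A `ℤᵈ`-periodic continuous function descends to the torus. -/
theorem exists_torus_lift {P : (d → ℝ) → ℂ} (hP : Continuous P)
    (hper : ∀ (n : d → ℤ) x, P (x + fun i => (n i : ℝ)) = P x) :
    ∃ Q : C(UnitAddTorus d, ℂ), ∀ x, Q (toTorus x) = P x := by
  have hlift : ∀ x y : d → ℝ, toTorus x = toTorus y → P x = P y := fun x y h => by
    obtain ⟨n, rfl⟩ := toTorus_eq_iff.mp h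
    rw [hper]
  refine ⟨isOpenQuotientMap_toTorus.isQuotientMap.lift
    (f := ⟨toTorus, isOpenQuotientMap_toTorus.continuous⟩) ⟨P, hP⟩ hlift, fun x => ?_⟩
  exact DFunLike.congr_fun (isOpenQuotientMap_toTorus.isQuotientMap.lift_comp
    (f := ⟨toTorus, isOpenQuotientMap_toTorus.continuous⟩) ⟨P, hP⟩ hlift) x

variable [Fintype d]

theorem integral_torus_eq (Q : UnitAddTorus d → ℂ) :
    ∫ t, Q t = ∫ x in Set.Icc (0 : d → ℝ) 1, Q (toTorus x) := by
  rw [UnitAddTorus.integral_preimage Q 0]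
  have hset : {x : d → ℝ | ∀ i, x i ∈ Set.Ioc ((0 : d → ℝ) i) ((0 : d → ℝ) i + 1)}
      = Set.pi Set.univ fun i => Set.Ioc ((0 : d → ℝ) i) ((1 : d → ℝ) i) := by
    ext x
    simp [Set.mem_pi]
  rw [hset]
  exact setIntegral_congr_set Measure.univ_pi_Ioc_ae_eq_Icc

/-- On the torus this is the translation invariance of Haar measure. -/
theorem setIntegral_periodic_add {P : (d → ℝ) → ℂ} (hP : Continuous P)
    (hper : ∀ (n : d → ℤ) x, P (x + fun i => (n i : ℝ)) = P x) (v : d → ℝ) :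
    ∫ x in Set.Icc (0 : d → ℝ) 1, P (x + v) = ∫ x in Set.Icc (0 : d → ℝ) 1, P x := by
  obtain ⟨Q, hQ⟩ := exists_torus_lift hP hper
  have h1 := integral_torus_eq (fun t => Q (t + toTorus v))
  have h2 := integral_torus_eq (d := d) Q
  rw [integral_add_right_eq_self (fun t => Q t) (toTorus v), h2] at h1
  simp only [← hQ]
  exact h1.symm

/-- An integral matrix induces a continuous endomorphism of the torus, and the right inverse `N`
makes it surjective. A surjective endomorphism of a compact group preserves normalized Haar measure,
so no Jacobian is needed. -/
theorem setIntegral_periodic_mulVec {P : (d → ℝ) → ℂ} (hP : Continuous P)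
    (hper : ∀ (n : d → ℤ) x, P (x + fun i => (n i : ℝ)) = P x) {M N : Matrix d d ℤ}
    (hMN : ∀ x : d → ℤ, M *ᵥ (N *ᵥ x) = x) :
    ∫ x in Set.Icc (0 : d → ℝ) 1, P (M.map (Int.cast : ℤ → ℝ) *ᵥ x)
      = ∫ x in Set.Icc (0 : d → ℝ) 1, P x := by
  classical
  obtain ⟨Q, hQ⟩ := exists_torus_lift hP hper
  let φ : Matrix d d ℤ → UnitAddTorus d →+ UnitAddTorus d := fun M =>
    { toFun := fun t i => ∑ j, M i j • t j
      map_zero' := by ext i; simp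
      map_add' := fun s t => by ext i; simp [Finset.sum_add_distrib] }
  have hφ : ∀ M x, φ M (toTorus x) = toTorus (M.map (Int.cast : ℤ → ℝ) *ᵥ x) := by
    intro M x
    funext i
    change ∑ j, M i j • (x j : UnitAddCircle) = ((∑ j, (M i j : ℝ) * x j : ℝ) : UnitAddCircle)
    have hsum : ((∑ j, (M i j : ℝ) * x j : ℝ) : UnitAddCircle)
        = ∑ j, (((M i j : ℝ) * x j : ℝ) : UnitAddCircle) :=
      map_sum (QuotientAddGroup.mk' (AddSubgroup.zmultiples (1 : ℝ))) _ _
    rw [hsum]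
    refine Finset.sum_congr rfl fun j _ => ?_
    rw [← zsmul_eq_mul]
    exact (map_zsmul (QuotientAddGroup.mk' (AddSubgroup.zmultiples (1 : ℝ))) _ _).symm
  have hcont : Continuous (φ M) := by
    refine continuous_pi fun i => continuous_finsetSum _ fun j _ => ?_
    exact (continuous_apply j).zsmul _
  have hMN' : M * N = 1 := by
    ext i j
    have := congrFun (hMN (Pi.single j 1)) i
    rw [Matrix.mulVec_mulVec, Matrix.mulVec_single_one] at this
    simpa [Matrix.one_apply, Pi.single_apply] using this
  have hsurj : Function.Surjective (φ M) := by
    intro t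
    obtain ⟨x, rfl⟩ := isOpenQuotientMap_toTorus.surjective t
    refine ⟨toTorus (N.map (Int.cast : ℤ → ℝ) *ᵥ x), ?_⟩
    rw [hφ, Matrix.mulVec_mulVec]
    have : M.map (Int.cast : ℤ → ℝ) * N.map (Int.cast : ℤ → ℝ) = 1 := by
      have h := congrArg (Int.castRingHom ℝ).mapMatrix hMN'
      rw [map_mul, map_one] at h
      exact h
    rw [this, Matrix.one_mulVec]
  have hmp := AddMonoidHom.measurePreserving (μ := (volume : Measure (UnitAddTorus d)))
    (ν := (volume : Measure (UnitAddTorus d))) hcont hsurj rfl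
  have h1 := integral_torus_eq (fun t => Q (φ M t))
  have h2 := integral_torus_eq (d := d) Q
  have h3 : ∫ t, Q (φ M t) = ∫ t, Q t := by
    rw [← integral_map hmp.measurable.aemeasurable (by
      exact Q.continuous.aestronglyMeasurable), hmp.map_eq]
  rw [h3, h2] at h1
  simp only [hφ, hQ] at h1
  exact h1.symm

/-- A continuous periodic function all of whose Fourier coefficients vanish is zero. -/
theorem periodic_eq_zero_of_fourier {P : (d → ℝ) → ℂ} (hP : Continuous P)
    (hper : ∀ (n : d → ℤ) x, P (x + fun i => (n i : ℝ)) = P x)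
    (h : ∀ n : d → ℤ, ∫ x in Set.Icc (0 : d → ℝ) 1,
      P x * Complex.exp (-(2 * Real.pi * Complex.I * ∑ i, (n i : ℂ) * x i)) = 0) (x : d → ℝ) :
    P x = 0 := by
  obtain ⟨Q, hQ⟩ := exists_torus_lift hP hper
  have hcoeff : UnitAddTorus.mFourierCoeff Q = 0 := by
    funext n
    rw [UnitAddTorus.mFourierCoeff, integral_torus_eq, Pi.zero_apply, ← h n]
    refine setIntegral_congr_fun measurableSet_Icc fun x _ => ?_
    simp only [hQ, smul_eq_mul]
    rw [mul_comm]
    congr 1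
    simp only [UnitAddTorus.mFourier, ContinuousMap.coe_mk, toTorus, fourier_coe_apply]
    rw [← Complex.exp_sum]
    congr 1
    rw [Finset.mul_sum, ← Finset.sum_neg_distrib]
    refine Finset.sum_congr rfl fun i _ => ?_
    simp
    ring
  have hsum := UnitAddTorus.hasSum_mFourier_series_apply_of_summable (f := Q)
    (by rw [hcoeff]; exact summable_zero) (toTorus x)
  rw [hcoeff, hQ] at hsum
  simp only [Pi.zero_apply, zero_smul] at hsum
  exact hsum.unique hasSum_zero

end Periodic

/-! ### Hermitian matrices of size two -/

theorem herm_form {T : Matrix (Fin 2) (Fin 2) ℂ} (hT : Tᴴ = T) (x : Fin 2 → ℂ) :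
    star x ⬝ᵥ (T *ᵥ x) = (((T 0 0).re * Complex.normSq (x 0) + (T 1 1).re * Complex.normSq (x 1)
      + 2 * (star (x 0) * T 0 1 * x 1).re : ℝ) : ℂ) := by
  have h0 : star (T 0 0) = T 0 0 := congrFun (congrFun hT 0) 0
  have h1 : star (T 1 1) = T 1 1 := congrFun (congrFun hT 1) 1
  have h2 : star (T 0 1) = T 1 0 := congrFun (congrFun hT 1) 0
  have i0 : (T 0 0).im = 0 := by
    have := congrArg Complex.im h0
    simp at this; linarith
  have i1 : (T 1 1).im = 0 := by
    have := congrArg Complex.im h1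
    simp at this; linarith
  simp only [dotProduct, mulVec, Fin.sum_univ_two, Pi.star_apply, ← h2]
  apply Complex.ext <;> simp [Complex.normSq_apply, i0, i1] <;> ring

theorem herm_det_re {T : Matrix (Fin 2) (Fin 2) ℂ} (hT : Tᴴ = T) :
    T.det.re = (T 0 0).re * (T 1 1).re - Complex.normSq (T 0 1) := by
  have h0 : star (T 0 0) = T 0 0 := congrFun (congrFun hT 0) 0
  have h2 : star (T 0 1) = T 1 0 := congrFun (congrFun hT 1) 0
  have i0 : (T 0 0).im = 0 := by
    have := congrArg Complex.im h0
    simp at this; linarith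
  rw [det_fin_two, ← h2]
  simp [Complex.normSq_apply, i0]

/-- Completing the square. Both the definiteness and the semidefiniteness criterion below are read
off from it. -/
theorem herm_form_mul (a c : ℝ) (b x y : ℂ) :
    a * (a * Complex.normSq x + c * Complex.normSq y + 2 * (star x * b * y).re)
      = Complex.normSq (a * x + b * y) + (a * c - Complex.normSq b) * Complex.normSq y := by
  simp [Complex.normSq_apply]
  ring

theorem posDef_fin_two_iff {T : Matrix (Fin 2) (Fin 2) ℂ} (hT : Tᴴ = T) :
    T.PosDef ↔ 0 < (T 0 0).re ∧ 0 < T.det.re := by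
  constructor
  · intro h
    exact ⟨(Complex.pos_iff.mp h.diag_pos).1, (Complex.pos_iff.mp h.det_pos).1⟩
  · rintro ⟨ha, hd⟩
    refine PosDef.of_dotProduct_mulVec_pos hT fun x hx => ?_
    rw [herm_form hT]
    have key := herm_form_mul (T 0 0).re (T 1 1).re (T 0 1) (x 0) (x 1)
    rw [← herm_det_re hT] at key
    have hpos : 0 < Complex.normSq (((T 0 0).re : ℂ) * x 0 + T 0 1 * x 1)
        + T.det.re * Complex.normSq (x 1) := by
      by_cases h1 : x 1 = 0
      · have h0 : x 0 ≠ 0 := fun h0 => hx (by ext i; fin_cases i <;> simp [h0, h1])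
        have : (((T 0 0).re : ℂ) * x 0) ≠ 0 := mul_ne_zero (by exact_mod_cast ha.ne') h0
        simpa [h1] using Complex.normSq_pos.mpr this
      · have := mul_pos hd (Complex.normSq_pos.mpr h1)
        linarith [Complex.normSq_nonneg (((T 0 0).re : ℂ) * x 0 + T 0 1 * x 1)]
    rw [← key] at hpos
    exact_mod_cast pos_of_mul_pos_right hpos ha.le

theorem posSemidef_fin_two {T : Matrix (Fin 2) (Fin 2) ℂ} (hT : Tᴴ = T)
    (ha : 0 < (T 0 0).re) (hd : 0 ≤ T.det.re) : T.PosSemidef := by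
  refine PosSemidef.of_dotProduct_mulVec_nonneg hT fun x => ?_
  rw [herm_form hT]
  have key := herm_form_mul (T 0 0).re (T 1 1).re (T 0 1) (x 0) (x 1)
  rw [← herm_det_re hT] at key
  have hpos : 0 ≤ Complex.normSq (((T 0 0).re : ℂ) * x 0 + T 0 1 * x 1)
      + T.det.re * Complex.normSq (x 1) :=
    add_nonneg (Complex.normSq_nonneg _) (mul_nonneg hd (Complex.normSq_nonneg _))
  rw [← key] at hpos
  exact_mod_cast nonneg_of_mul_nonneg_right hpos ha

/-! ### The Hermitian half space -/

theorem herm_add_I_smul_mem_halfSpace {X Y : Matrix (Fin 2) (Fin 2) ℂ} (hX : Xᴴ = X)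
    (hY : Yᴴ = Y) : X + Complex.I • Y ∈ halfSpace ↔ Y.PosDef := by
  have : (1 / (2 * Complex.I)) • (X + Complex.I • Y - (X + Complex.I • Y)ᴴ) = Y := by
    rw [conjTranspose_add, conjTranspose_smul, hX, hY]
    rw [show X + Complex.I • Y - (X + star Complex.I • Y) = (2 * Complex.I) • Y by
      simp only [Complex.star_def, Complex.conj_I]
      module, smul_smul, one_div, inv_mul_cancel₀ (by simp), one_smul]
  rw [halfSpace, Set.mem_ofPred_eq, this]

theorem isHermitian_imPart (Z : Matrix (Fin 2) (Fin 2) ℂ) :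
    ((1 / (2 * Complex.I)) • (Z - Zᴴ))ᴴ = (1 / (2 * Complex.I)) • (Z - Zᴴ) := by
  rw [conjTranspose_smul, conjTranspose_sub, conjTranspose_conjTranspose, ← neg_sub Z, smul_neg,
    ← neg_smul]
  congr 1
  simp

theorem exists_herm_decomposition (Z : Matrix (Fin 2) (Fin 2) ℂ) :
    ∃ X : Matrix (Fin 2) (Fin 2) ℂ, Xᴴ = X ∧
      Z = X + Complex.I • ((1 / (2 * Complex.I)) • (Z - Zᴴ)) := by
  refine ⟨(1 / 2 : ℂ) • (Z + Zᴴ), ?_, ?_⟩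
  · rw [conjTranspose_smul, conjTranspose_add, conjTranspose_conjTranspose, add_comm]
    simp
  · rw [smul_smul, show Complex.I * (1 / (2 * Complex.I)) = 1 / 2 by field_simp [Complex.I_ne_zero]]
    module

theorem isOpen_halfSpace : IsOpen halfSpace := by
  have : halfSpace = {Z | 0 < (((1 / (2 * Complex.I)) • (Z - Zᴴ)) 0 0).re} ∩
      {Z | 0 < ((1 / (2 * Complex.I)) • (Z - Zᴴ)).det.re} := by
    ext Z
    exact posDef_fin_two_iff (isHermitian_imPart Z)
  rw [this]
  have hc : Continuous fun Z : Matrix (Fin 2) (Fin 2) ℂ => (1 / (2 * Complex.I)) • (Z - Zᴴ) := by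
    have h : Continuous fun Z : Matrix (Fin 2) (Fin 2) ℂ => Z - Zᴴ :=
      continuous_id.sub continuous_id.matrix_conjTranspose
    fun_prop
  refine IsOpen.inter ?_ ?_
  · exact isOpen_lt continuous_const (Complex.continuous_re.comp (hc.matrix_elem 0 0))
  · exact isOpen_lt continuous_const (Complex.continuous_re.comp hc.matrix_det)

/-- The parameters `s` for which the point `X + i Y + s B` lies in the half space. -/
def lineDomain (X Y B : Matrix (Fin 2) (Fin 2) ℂ) : Set ℂ :=
  {s | X + Complex.I • Y + s • B ∈ halfSpace}

theorem isOpen_lineDomain (X Y B : Matrix (Fin 2) (Fin 2) ℂ) : IsOpen (lineDomain X Y B) :=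
  isOpen_halfSpace.preimage (by fun_prop : Continuous fun s : ℂ => X + Complex.I • Y + s • B)

theorem mem_lineDomain {X Y B : Matrix (Fin 2) (Fin 2) ℂ} (hX : Xᴴ = X) (hY : Yᴴ = Y)
    (hB : Bᴴ = B) {s : ℂ} : s ∈ lineDomain X Y B ↔ (Y + (s.im : ℂ) • B).PosDef := by
  have e : X + Complex.I • Y + s • B
      = (X + (s.re : ℂ) • B) + Complex.I • (Y + (s.im : ℂ) • B) := by
    conv_lhs => rw [← Complex.re_add_im s]
    rw [add_smul, smul_add, smul_smul, mul_comm Complex.I]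
    abel
  rw [lineDomain, Set.mem_ofPred_eq, e, herm_add_I_smul_mem_halfSpace]
  · simp [hX, hB]
  · simp [hY, hB]

/-- Convexity supplies the connectedness that the identity theorem needs. -/
theorem convex_lineDomain {X Y B : Matrix (Fin 2) (Fin 2) ℂ} (hX : Xᴴ = X) (hY : Yᴴ = Y)
    (hB : Bᴴ = B) : Convex ℝ (lineDomain X Y B) := by
  rw [convex_iff_forall_pos]
  intro s hs t ht a b ha hb hab
  rw [mem_lineDomain hX hY hB] at *
  have e : Y + ((a • s + b • t).im : ℂ) • B
      = (a : ℂ) • (Y + (s.im : ℂ) • B) + (b : ℂ) • (Y + (t.im : ℂ) • B) := by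
    have h1 : (a : ℂ) + b = 1 := by exact_mod_cast hab
    rw [smul_add, smul_add, add_add_add_comm, ← add_smul, h1, one_smul, smul_smul, smul_smul,
      ← add_smul]
    simp
  rw [e]
  have ha' : (0 : ℂ) < a := by exact_mod_cast ha
  have hb' : (0 : ℂ) < b := by exact_mod_cast hb
  exact (hs.smul ha').add (ht.smul hb')

/-- With $N=CZ+D$, the unitarity relation gives
$\overline{N}^{tr}(AZ+B)-\overline{(AZ+B)}^{tr}N=Z-\overline{Z}^{tr}$. A kernel vector of $N$ would
be isotropic for the positive definite imaginary part of $Z$, and dividing by $N$ on both sides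
shows that the imaginary part of $M\langle Z\rangle$ is congruent to that of $Z$. -/
theorem det_denom_ne_zero_and_act_mem {M : Matrix (Fin 2 ⊕ Fin 2) (Fin 2 ⊕ Fin 2) ℂ}
    (hM : M ∈ specialUnitary) {Z : Matrix (Fin 2) (Fin 2) ℂ} (hZ : Z ∈ halfSpace) :
    (denom M Z).det ≠ 0 ∧ act M Z ∈ halfSpace := by
  obtain ⟨-, hJ⟩ := hM
  set A := M.toBlocks₁₁ with hA
  set B := M.toBlocks₁₂ with hB
  set C := M.toBlocks₂₁ with hC
  set D := M.toBlocks₂₂ with hD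
  have hMb : M = fromBlocks A B C D := (fromBlocks_toBlocks M).symm
  rw [hMb, J, fromBlocks_conjTranspose, fromBlocks_multiply, fromBlocks_multiply,
    fromBlocks_inj] at hJ
  obtain ⟨h1, h2, h3, h4⟩ := hJ
  simp only [mul_zero, zero_add, mul_one, mul_neg, add_zero, neg_mul] at h1 h2 h3 h4
  have key : (denom M Z)ᴴ * (A * Z + B) - (A * Z + B)ᴴ * denom M Z = Z - Zᴴ := by
    have e : (denom M Z)ᴴ * (A * Z + B) - (A * Z + B)ᴴ * denom M Z
        = Zᴴ * (Cᴴ * A + -(Aᴴ * C)) * Z + Zᴴ * (Cᴴ * B + -(Aᴴ * D))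
          + (Dᴴ * A + -(Bᴴ * C)) * Z + (Dᴴ * B + -(Bᴴ * D)) := by
      simp only [denom, ← hC, ← hD, conjTranspose_add, conjTranspose_mul]
      noncomm_ring
    rw [e, h1, h2, h3, h4]
    noncomm_ring
  have hdet : (denom M Z).det ≠ 0 := by
    intro h0
    obtain ⟨v, hv, hv0⟩ := exists_mulVec_eq_zero_iff.mpr h0
    have hp := PosDef.dotProduct_mulVec_pos hZ hv
    rw [← key, smul_mulVec, sub_mulVec, ← mulVec_mulVec v _ (denom M Z), hv0,
      ← mulVec_mulVec, dotProduct_smul, dotProduct_sub, dotProduct_mulVec (star v),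
      ← star_mulVec, hv0] at hp
    simp at hp
  refine ⟨hdet, ?_⟩
  have hu : IsUnit (denom M Z).det := isUnit_iff_ne_zero.mpr hdet
  have hu' : IsUnit ((denom M Z)ᴴ).det := by rwa [det_conjTranspose, isUnit_star]
  have e : (1 / (2 * Complex.I)) • (act M Z - (act M Z)ᴴ)
      = ((denom M Z)⁻¹)ᴴ * ((1 / (2 * Complex.I)) • (Z - Zᴴ)) * (denom M Z)⁻¹ := by
    rw [← key, Matrix.mul_smul, Matrix.smul_mul, mul_sub, sub_mul]
    congr 2
    · rw [conjTranspose_nonsing_inv, ← mul_assoc, nonsing_inv_mul _ hu', one_mul]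
      rfl
    · rw [mul_assoc, mul_assoc, mul_nonsing_inv _ hu, mul_one, act, conjTranspose_mul]
  rw [halfSpace, Set.mem_ofPred_eq, e]
  refine PosDef.conjTranspose_mul_mul_same hZ ?_
  exact mulVec_injective_of_isUnit ((isUnit_iff_isUnit_det _).mpr (isUnit_nonsing_inv_det _ hu))

/-! ### Holomorphic functions along complex lines -/

/-- A holomorphic function on the half space, seen as a function of the four entries. -/
theorem differentiableOn_entries {f : Matrix (Fin 2) (Fin 2) ℂ → ℂ}
    (hf : DifferentiableOn ℂ f halfSpace) :
    DifferentiableOn ℂ (fun Z : Fin 2 → Fin 2 → ℂ => f (Matrix.of Z))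
      {Z : Fin 2 → Fin 2 → ℂ | Matrix.of Z ∈ halfSpace} :=
  hf

theorem continuousOn_of_differentiableOn {f : Matrix (Fin 2) (Fin 2) ℂ → ℂ}
    (hf : DifferentiableOn ℂ f halfSpace) : ContinuousOn f halfSpace :=
  (differentiableOn_entries hf).continuousOn

theorem differentiableOn_line {f : Matrix (Fin 2) (Fin 2) ℂ → ℂ}
    (hf : DifferentiableOn ℂ f halfSpace) (Z B : Matrix (Fin 2) (Fin 2) ℂ) {U : Set ℂ}
    (hU : ∀ s ∈ U, Z + s • B ∈ halfSpace) :
    DifferentiableOn ℂ (fun s : ℂ => f (Z + s • B)) U := by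
  have h1 : DifferentiableOn ℂ (fun (s : ℂ) (i j : Fin 2) => Z i j + s * B i j) U := by
    fun_prop
  exact (differentiableOn_entries hf).comp h1 hU

/-! ### Coordinates of Hermitian matrices -/

theorem sqrtDisc_eq (m : ℕ) : sqrtDisc m = omega m - star (omega m) := by
  unfold sqrtDisc omega disc
  split_ifs with h
  · have : -(((-(m : ℤ) : ℤ)) : ℝ) = m := by push_cast; ring
    rw [this]
    simp [sqrtNeg]
    ring
  · have : -(((-4 * (m : ℤ) : ℤ)) : ℝ) = 2 ^ 2 * m := by push_cast; ring
    rw [this, Real.sqrt_mul (by norm_num), Real.sqrt_sq (by norm_num)]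
    simp [sqrtNeg]
    ring

theorem sqrtDisc_ne_zero {m : ℕ} (hm : 0 < m) : sqrtDisc m ≠ 0 := by
  unfold sqrtDisc
  refine mul_ne_zero Complex.I_ne_zero (Complex.ofReal_ne_zero.mpr (Real.sqrt_ne_zero'.mpr ?_))
  have : (0 : ℝ) < m := by exact_mod_cast hm
  unfold disc
  split_ifs <;> push_cast <;> linarith

theorem star_sqrtDisc (m : ℕ) : star (sqrtDisc m) = -sqrtDisc m := by
  simp [sqrtDisc]

theorem omega_im_ne_zero {m : ℕ} (hm : 0 < m) : (omega m).im ≠ 0 := by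
  intro h
  apply sqrtDisc_ne_zero hm
  rw [sqrtDisc_eq]
  apply Complex.ext <;> simp [h]

theorem omega_mem_ringInt (m : ℕ) : omega m ∈ ringInt m := ⟨0, 1, by simp⟩

theorem intCast_mem_ringInt (m : ℕ) (n : ℤ) : (n : ℂ) ∈ ringInt m := ⟨n, 0, by simp⟩

theorem hermCoord_conjTranspose (m : ℕ) (x : Fin 4 → ℝ) : (hermCoord m x)ᴴ = hermCoord m x := by
  ext i j
  fin_cases i <;> fin_cases j <;> simp [hermCoord]

theorem hermCoord_add (m : ℕ) (x y : Fin 4 → ℝ) :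
    hermCoord m (x + y) = hermCoord m x + hermCoord m y := by
  ext i j
  fin_cases i <;> fin_cases j <;> simp [hermCoord] <;> ring

theorem hermCoord_smul (m : ℕ) (a : ℝ) (x : Fin 4 → ℝ) :
    hermCoord m (a • x) = (a : ℂ) • hermCoord m x := by
  ext i j
  fin_cases i <;> fin_cases j <;> simp [hermCoord] <;> ring

theorem continuous_hermCoord (m : ℕ) : Continuous (hermCoord m) := by
  refine continuous_matrix fun i j => ?_
  fin_cases i <;> fin_cases j <;> simp [hermCoord] <;> fun_prop

theorem hermCoord_eq_sum (m : ℕ) (x : Fin 4 → ℝ) :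
    hermCoord m x = ∑ j, (x j : ℂ) • hermCoord m (Pi.single j 1) := by
  rw [Fin.sum_univ_four]
  ext i j
  fin_cases i <;> fin_cases j <;> simp [hermCoord]

theorem herm_diag_re {T : Matrix (Fin 2) (Fin 2) ℂ} (hT : Tᴴ = T) (i : Fin 2) :
    T i i = ((T i i).re : ℂ) := by
  have := congrArg Complex.im (congrFun (congrFun hT i) i)
  apply Complex.ext
  · simp
  · simp at this ⊢
    linarith

theorem exists_hermCoord_eq {m : ℕ} (hm : 0 < m) {X : Matrix (Fin 2) (Fin 2) ℂ} (hX : Xᴴ = X) :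
    ∃ x, X = hermCoord m x := by
  have ho := omega_im_ne_zero hm
  let c : ℝ := (X 0 1).im / (omega m).im
  have h01 : X 0 1 = (((X 0 1).re - c * (omega m).re : ℝ) : ℂ) + (c : ℂ) * omega m := by
    apply Complex.ext
    · simp
    · simp [c]
      field_simp
  refine ⟨![(X 0 0).re, (X 0 1).re - c * (omega m).re, c, (X 1 1).re], ?_⟩
  have h10 : X 1 0 = star (X 0 1) := (congrFun (congrFun hX 1) 0).symm
  ext i j
  fin_cases i <;> fin_cases j
  · simpa [hermCoord] using herm_diag_re hX 0
  · simpa [hermCoord] using h01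
  · change X 1 0 = _
    rw [h10, h01]
    simp [hermCoord]
  · simpa [hermCoord] using herm_diag_re hX 1

/-- The Hermitian matrices over `𝒪`. -/
def integralHerm (m : ℕ) : Set (Matrix (Fin 2) (Fin 2) ℂ) :=
  {S | Sᴴ = S ∧ ∀ i j, S i j ∈ ringInt m}

theorem mem_integralHerm_iff {m : ℕ} {S : Matrix (Fin 2) (Fin 2) ℂ} :
    S ∈ integralHerm m ↔ ∃ n : Fin 4 → ℤ, S = hermCoord m fun i => (n i : ℝ) := by
  constructor
  · rintro ⟨hS, hO⟩
    have hdiag : ∀ i, ∃ k : ℤ, S i i = k := fun i =>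
      exists_int_of_mem_ringInt (hO i i) (by rw [herm_diag_re hS i]; simp)
    obtain ⟨k, hk⟩ := hdiag 0
    obtain ⟨l, hl⟩ := hdiag 1
    obtain ⟨a, b, hab⟩ := hO 0 1
    have h10 : S 1 0 = star (S 0 1) := (congrFun (congrFun hS 1) 0).symm
    refine ⟨![k, a, b, l], ?_⟩
    ext i j
    fin_cases i <;> fin_cases j
    · simpa [hermCoord] using hk
    · simpa [hermCoord] using hab
    · change S 1 0 = _
      rw [h10, hab]
      simp [hermCoord]
    · simpa [hermCoord] using hl
  · rintro ⟨n, rfl⟩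
    refine ⟨hermCoord_conjTranspose m _, fun i j => ?_⟩
    have h : ((n 1 : ℂ) + n 2 * omega m) ∈ ringInt m := ⟨n 1, n 2, rfl⟩
    fin_cases i <;> fin_cases j
    · simp [hermCoord]
    · simpa [hermCoord] using h
    · simpa [hermCoord] using star_mem_ringInt h
    · simp [hermCoord]

/-- The element of the dual lattice with given coordinates. -/
def dualCoord (m : ℕ) (n : Fin 4 → ℤ) : Matrix (Fin 2) (Fin 2) ℂ :=
  !![(n 0 : ℂ), (sqrtDisc m)⁻¹ * (-n 2 + n 1 * omega m);
    star ((sqrtDisc m)⁻¹ * (-n 2 + n 1 * omega m)), (n 3 : ℂ)]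

theorem mem_fourierLattice_iff {m : ℕ} {T : Matrix (Fin 2) (Fin 2) ℂ} :
    T ∈ fourierLattice m ↔ ∃ n : Fin 4 → ℤ, T = dualCoord m n := by
  constructor
  · rintro ⟨hT, hd, ho⟩
    obtain ⟨k, hk⟩ := hd 0
    obtain ⟨l, hl⟩ := hd 1
    obtain ⟨_, ⟨a, b, rfl⟩, hab⟩ := ho 0 1 (by decide)
    have h10 : T 1 0 = star (T 0 1) := (congrFun (congrFun hT 1) 0).symm
    refine ⟨![k, b, -a, l], ?_⟩
    ext i j
    fin_cases i <;> fin_cases j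
    · simpa [dualCoord] using hk
    · simpa [dualCoord] using hab
    · change T 1 0 = _
      rw [h10, hab]
      simp [dualCoord]
    · simpa [dualCoord] using hl
  · rintro ⟨n, rfl⟩
    have h : (-(n 2 : ℂ) + n 1 * omega m) ∈ ringInt m := ⟨-n 2, n 1, by push_cast; rfl⟩
    refine ⟨?_, fun i => ?_, fun i j hij => ?_⟩
    · ext i j
      fin_cases i <;> fin_cases j <;> simp [dualCoord]
    · fin_cases i
      · exact ⟨n 0, by simp [dualCoord]⟩
      · exact ⟨n 3, by simp [dualCoord]⟩
    · fin_cases i <;> fin_cases j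
      · exact absurd rfl hij
      · exact ⟨_, h, by simp [dualCoord]⟩
      · refine ⟨-star (-(n 2 : ℂ) + n 1 * omega m), neg_mem (star_mem_ringInt h), ?_⟩
        change star ((sqrtDisc m)⁻¹ * (-n 2 + n 1 * omega m)) = _
        rw [star_mul', star_inv₀, star_sqrtDisc, inv_neg]
        ring
      · exact absurd rfl hij

/-- The swapped and signed middle coordinates of `dualCoord` are chosen to make this pairing the
standard one; the reason it works is $\sqrt{d_{\mathbb{K}}}=\omega-\overline{\omega}$. -/
theorem trace_dualCoord_mul {m : ℕ} (hm : 0 < m) (n : Fin 4 → ℤ) (x : Fin 4 → ℝ) :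
    (dualCoord m n * hermCoord m x).trace = ∑ i, (n i : ℂ) * x i := by
  have hs := sqrtDisc_ne_zero hm
  have e := sqrtDisc_eq m
  rw [Fin.sum_univ_four, trace_fin_two]
  have e2 : star ((sqrtDisc m)⁻¹ * (-(n 2 : ℂ) + n 1 * omega m))
      = -((sqrtDisc m)⁻¹ * (-(n 2 : ℂ) + n 1 * star (omega m))) := by
    rw [star_mul', star_inv₀, star_sqrtDisc, star_add, star_mul', star_neg]
    simp only [inv_neg, star_intCast]
    ring
  simp only [dualCoord, hermCoord, mul_fin_two, e2]
  simp only [of_apply, cons_val', cons_val_zero, cons_val_one, cons_val_fin_one, star_add,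
    star_mul', Complex.star_def, Complex.conj_ofReal] at e ⊢
  generalize sqrtDisc m = D at *
  field_simp
  rw [e]
  ring

/-- Thus $\Lambda$ is the trace dual of the integral Hermitian matrices. For the converse, the
traces against a basis determine a candidate `dualCoord m n`; its difference from `T` is Hermitian
and orthogonal to every Hermitian matrix, itself included, hence zero. -/
theorem mem_fourierLattice_iff_trace {m : ℕ} (hm : 0 < m) {T : Matrix (Fin 2) (Fin 2) ℂ} :
    T ∈ fourierLattice m ↔ Tᴴ = T ∧ ∀ S ∈ integralHerm m, ∃ k : ℤ, (T * S).trace = k := by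
  constructor
  · intro h
    refine ⟨h.1, fun S hS => ?_⟩
    obtain ⟨n, rfl⟩ := mem_fourierLattice_iff.mp h
    obtain ⟨k, rfl⟩ := mem_integralHerm_iff.mp hS
    exact ⟨∑ i, n i * k i, by rw [trace_dualCoord_mul hm]; push_cast; rfl⟩
  · rintro ⟨hT, h⟩
    have hj : ∀ j : Fin 4, ∃ k : ℤ, (T * hermCoord m (Pi.single j 1)).trace = k := fun j => by
      refine h _ (mem_integralHerm_iff.mpr ⟨Pi.single j 1, ?_⟩)
      congr 1
      funext i
      by_cases hij : i = j
      · subst hij; simp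
      · simp [hij]
    choose n hn using hj
    have hD : dualCoord m n ∈ fourierLattice m := mem_fourierLattice_iff.mpr ⟨n, rfl⟩
    have htr : ∀ x, ((T - dualCoord m n) * hermCoord m x).trace = 0 := fun x => by
      rw [sub_mul, trace_sub, trace_dualCoord_mul hm, hermCoord_eq_sum, Finset.mul_sum, trace_sum,
        ← Finset.sum_sub_distrib]
      refine Finset.sum_eq_zero fun i _ => ?_
      rw [Matrix.mul_smul, trace_smul, hn, smul_eq_mul]
      ring
    have hH : (T - dualCoord m n)ᴴ = T - dualCoord m n := by
      rw [conjTranspose_sub, hT, hD.1]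
    obtain ⟨y, hy⟩ := exists_hermCoord_eq hm hH
    have h0 := htr y
    rw [← hy] at h0
    nth_rewrite 1 [← hH] at h0
    rw [trace_conjTranspose_mul_self_eq_zero_iff, sub_eq_zero] at h0
    rw [h0]
    exact hD

/-! ### Translations and unimodular substitutions -/

theorem translation_mem_modularGroup {m : ℕ} {S : Matrix (Fin 2) (Fin 2) ℂ}
    (hS : S ∈ integralHerm m) : fromBlocks 1 S 0 1 ∈ modularGroup m := by
  refine ⟨⟨by simp, ?_⟩, fun i j => ?_⟩
  · rw [J, fromBlocks_conjTranspose, fromBlocks_multiply, fromBlocks_multiply]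
    simp [hS.1]
  · have h1 : ∀ i j : Fin 2, (1 : Matrix (Fin 2) (Fin 2) ℂ) i j ∈ ringInt m := fun i j => by
      rw [one_apply]
      split_ifs
      · exact one_mem _
      · exact zero_mem _
    rcases i with i | i <;> rcases j with j | j
    · exact h1 i j
    · exact hS.2 i j
    · exact zero_mem (ringInt m)
    · exact h1 i j

theorem modularForm_add {m : ℕ} {r : ℤ} {f : Matrix (Fin 2) (Fin 2) ℂ → ℂ}
    (hf : f ∈ modularForms (modularGroup m) r) {S Z : Matrix (Fin 2) (Fin 2) ℂ}
    (hS : S ∈ integralHerm m) (hZ : Z ∈ halfSpace) : f (Z + S) = f Z := by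
  have := hf.2 _ (translation_mem_modularGroup hS) Z hZ
  simpa [act, denom] using this

/-- Since $\det A=1$, the block diagonal factor leaves the automorphy factor unchanged; this is what
reduces the extended group to the substitutions $Z\mapsto AZ\overline{A}^{tr}$. -/
theorem act_blockDiagonal {A : Matrix (Fin 2) (Fin 2) ℂ} (hA : A.det = 1)
    (G : Matrix (Fin 2 ⊕ Fin 2) (Fin 2 ⊕ Fin 2) ℂ) (Z : Matrix (Fin 2) (Fin 2) ℂ) :
    act (fromBlocks A 0 0 (Aᴴ)⁻¹ * G) Z = A * act G Z * Aᴴ ∧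
      (denom (fromBlocks A 0 0 (Aᴴ)⁻¹ * G) Z).det = (denom G Z).det := by
  have hu : IsUnit (Aᴴ).det := by rw [det_conjTranspose, hA]; simp
  have hG : fromBlocks A 0 0 (Aᴴ)⁻¹ * G = fromBlocks (A * G.toBlocks₁₁) (A * G.toBlocks₁₂)
      ((Aᴴ)⁻¹ * G.toBlocks₂₁) ((Aᴴ)⁻¹ * G.toBlocks₂₂) := by
    conv_lhs => rw [← fromBlocks_toBlocks G, fromBlocks_multiply]
    simp
  have hd : denom (fromBlocks A 0 0 (Aᴴ)⁻¹ * G) Z = (Aᴴ)⁻¹ * denom G Z := by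
    simp [denom, hG, mul_add, mul_assoc]
  constructor
  · rw [act, hd, Matrix.mul_inv_rev, nonsing_inv_nonsing_inv _ hu, hG]
    simp only [act, toBlocks_fromBlocks₁₁, toBlocks_fromBlocks₁₂, mul_assoc]
    rw [← mul_add, mul_assoc]
  · rw [hd, det_mul, det_nonsing_inv, det_conjTranspose, hA]
    simp

theorem one_mem_modularGroup (m : ℕ) : (1 : Matrix (Fin 2 ⊕ Fin 2) (Fin 2 ⊕ Fin 2) ℂ) ∈
    modularGroup m := by
  have := translation_mem_modularGroup (m := m) (S := 0) ⟨by simp, fun i j => by simp⟩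
  rwa [fromBlocks_one] at this

theorem act_one (Z : Matrix (Fin 2) (Fin 2) ℂ) : act 1 Z = Z ∧ denom 1 Z = 1 := by
  rw [← fromBlocks_one]
  simp only [act, denom, toBlocks_fromBlocks₁₁, toBlocks_fromBlocks₁₂, toBlocks_fromBlocks₂₁,
    toBlocks_fromBlocks₂₂]
  simp

/-- Invariance under the extended modular group in terms of invariance under its block diagonal
matrices. -/
theorem mem_modularForms_extendedGroup_iff {m : ℕ} {r : ℤ} {f : Matrix (Fin 2) (Fin 2) ℂ → ℂ}
    (hf : f ∈ modularForms (modularGroup m) r) :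
    f ∈ modularForms (extendedGroup m) r ↔
      ∀ A ∈ extensionMatrices m, ∀ Z ∈ halfSpace, f (A * Z * Aᴴ) = f Z := by
  constructor
  · rintro ⟨-, h⟩ A hA Z hZ
    have h1 := h _ ⟨A, hA, 1, one_mem_modularGroup m, rfl⟩ Z hZ
    obtain ⟨h2, h3⟩ := act_blockDiagonal hA.1 1 Z
    rw [h2, h3, (act_one Z).1, (act_one Z).2] at h1
    simpa using h1
  · intro h
    refine ⟨hf.1, ?_⟩
    rintro _ ⟨A, hA, G, hG, rfl⟩ Z hZ
    obtain ⟨h2, h3⟩ := act_blockDiagonal hA.1 G Z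
    rw [h2, h3, h A hA _ (det_denom_ne_zero_and_act_mem hG.1 hZ).2, hf.2 G hG Z hZ]

theorem modularForm_unimodular {m : ℕ} {r : ℤ} {f : Matrix (Fin 2) (Fin 2) ℂ → ℂ}
    (hf : f ∈ modularForms (modularGroup m) r) {U Z : Matrix (Fin 2) (Fin 2) ℂ}
    (hU : U.det = 1) (hO : ∀ i j, U i j ∈ ringInt m) (hZ : Z ∈ halfSpace) :
    f (U * Z * Uᴴ) = f Z := by
  have hu : IsUnit (Uᴴ).det := by rw [det_conjTranspose, hU]; simp
  have hmem : fromBlocks U 0 0 (Uᴴ)⁻¹ ∈ modularGroup m := by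
    refine ⟨⟨?_, ?_⟩, fun i j => ?_⟩
    · rw [det_fromBlocks_zero₂₁, det_nonsing_inv, det_conjTranspose, hU]
      simp
    · rw [J, fromBlocks_conjTranspose, fromBlocks_multiply, fromBlocks_multiply]
      simp [mul_nonsing_inv _ hu, conjTranspose_nonsing_inv, hU]
    · have hi : ∀ i j, (Uᴴ)⁻¹ i j ∈ ringInt m := fun i j => by
        have h1 : (Uᴴ).det = 1 := by rw [det_conjTranspose, hU]; simp
        rw [inv_def, h1, adjugate_fin_two]
        have := fun i j => star_mem_ringInt (hO i j)
        fin_cases i <;> fin_cases j <;> simp <;> exact this _ _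
      rcases i with i | i <;> rcases j with j | j
      · exact hO i j
      · exact zero_mem (ringInt m)
      · exact zero_mem (ringInt m)
      · exact hi i j
  have h := hf.2 _ hmem Z hZ
  obtain ⟨h2, h3⟩ := act_blockDiagonal hU 1 Z
  rw [mul_one] at h2 h3
  rw [h2, h3, (act_one Z).1, (act_one Z).2] at h
  simpa using h

/-! ### Fourier coefficients -/

theorem conj_mem_halfSpace {A Z : Matrix (Fin 2) (Fin 2) ℂ} (hA : IsUnit A)
    (hZ : Z ∈ halfSpace) : A * Z * Aᴴ ∈ halfSpace := by
  have e : (1 / (2 * Complex.I)) • (A * Z * Aᴴ - (A * Z * Aᴴ)ᴴ)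
      = A * ((1 / (2 * Complex.I)) • (Z - Zᴴ)) * Aᴴ := by
    rw [Matrix.mul_smul, Matrix.smul_mul, mul_sub, sub_mul, conjTranspose_mul, conjTranspose_mul,
      conjTranspose_conjTranspose, mul_assoc A Zᴴ]
  rw [halfSpace, Set.mem_ofPred_eq, e]
  exact PosDef.mul_mul_conjTranspose_same hZ (vecMul_injective_of_isUnit hA)

/-- The identity theorem, with the reals accumulating at `0`. It carries a statement from height $I$
to any height $Y$: along $X+iI+s(Y-I)$ real `s` only translates, while `s = I` reaches $X+iY$. -/
theorem eq_zero_of_eq_zero_on_reals {U : Set ℂ} (hU : IsOpen U) (hconv : Convex ℝ U)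
    (h0 : (0 : ℂ) ∈ U) {F : ℂ → ℂ} (hF : DifferentiableOn ℂ F U) (hr : ∀ s : ℝ, F s = 0) :
    ∀ s ∈ U, F s = 0 := by
  refine AnalyticOnNhd.eqOn_of_preconnected_of_frequently_eq (hF.analyticOnNhd hU)
    analyticOnNhd_const hconv.isPreconnected h0 ?_
  have ht : Filter.Tendsto (fun s : ℝ => (s : ℂ)) (nhdsWithin 0 {0}ᶜ) (nhdsWithin 0 {0}ᶜ) := by
    refine tendsto_nhdsWithin_iff.mpr ⟨?_, ?_⟩
    · exact (by simpa using Complex.continuous_ofReal.tendsto 0 :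
        Filter.Tendsto (fun s : ℝ => (s : ℂ)) (nhds 0) (nhds 0)).mono_left nhdsWithin_le_nhds
    · filter_upwards [self_mem_nhdsWithin] with s hs
      simpa using hs
  exact ht.frequently (Filter.Eventually.of_forall hr).frequently

/-- The integrand of the Fourier coefficients. -/
def twist (f : Matrix (Fin 2) (Fin 2) ℂ → ℂ) (T Z : Matrix (Fin 2) (Fin 2) ℂ) : ℂ :=
  f Z * Complex.exp (-(2 * Real.pi * Complex.I * (T * Z).trace))

theorem continuousOn_twist {f : Matrix (Fin 2) (Fin 2) ℂ → ℂ} (hf : ContinuousOn f halfSpace)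
    (T : Matrix (Fin 2) (Fin 2) ℂ) : ContinuousOn (twist f T) halfSpace := by
  have h : Continuous fun Z : Matrix (Fin 2) (Fin 2) ℂ => (T * Z).trace :=
    (continuous_const.matrix_mul continuous_id).matrix_trace
  exact hf.mul (by fun_prop)

theorem differentiableOn_twist_line {f : Matrix (Fin 2) (Fin 2) ℂ → ℂ}
    (hf : DifferentiableOn ℂ f halfSpace) (T Z B : Matrix (Fin 2) (Fin 2) ℂ) {U : Set ℂ}
    (hU : ∀ s ∈ U, Z + s • B ∈ halfSpace) :
    DifferentiableOn ℂ (fun s : ℂ => twist f T (Z + s • B)) U := by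
  refine (differentiableOn_line hf Z B hU).mul ?_
  simp only [mul_add, Matrix.mul_smul, trace_add, trace_smul]
  fun_prop

theorem hermCoord_add_mem_halfSpace (m : ℕ) (x : Fin 4 → ℝ) {Y : Matrix (Fin 2) (Fin 2) ℂ}
    (hY : Y.PosDef) : hermCoord m x + Complex.I • Y ∈ halfSpace :=
  (herm_add_I_smul_mem_halfSpace (hermCoord_conjTranspose m x) hY.1).mpr hY

theorem continuous_twist_hermCoord {m : ℕ} {f : Matrix (Fin 2) (Fin 2) ℂ → ℂ}
    (hf : ContinuousOn f halfSpace) (T : Matrix (Fin 2) (Fin 2) ℂ)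
    {Y : Matrix (Fin 2) (Fin 2) ℂ} (hY : Y.PosDef) :
    Continuous fun x => twist f T (hermCoord m x + Complex.I • Y) :=
  (continuousOn_twist hf T).comp_continuous
    ((continuous_hermCoord m).add continuous_const)
    fun x => hermCoord_add_mem_halfSpace m x hY

theorem twist_add {m : ℕ} (hm : 0 < m) {f : Matrix (Fin 2) (Fin 2) ℂ → ℂ}
    (hf : ∀ S ∈ integralHerm m, ∀ Z ∈ halfSpace, f (Z + S) = f Z)
    {T : Matrix (Fin 2) (Fin 2) ℂ} (hT : T ∈ fourierLattice m) {S Z : Matrix (Fin 2) (Fin 2) ℂ}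
    (hS : S ∈ integralHerm m) (hZ : Z ∈ halfSpace) : twist f T (Z + S) = twist f T Z := by
  obtain ⟨k, hk⟩ := ((mem_fourierLattice_iff_trace hm).mp hT).2 S hS
  rw [twist, twist, hf S hS Z hZ, mul_add, trace_add, hk]
  congr 1
  rw [Complex.exp_eq_exp_iff_exists_int]
  exact ⟨-k, by push_cast; ring⟩

theorem twist_hermCoord_periodic {m : ℕ} (hm : 0 < m) {f : Matrix (Fin 2) (Fin 2) ℂ → ℂ}
    (hf : ∀ S ∈ integralHerm m, ∀ Z ∈ halfSpace, f (Z + S) = f Z)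
    {T : Matrix (Fin 2) (Fin 2) ℂ} (hT : T ∈ fourierLattice m)
    {Y : Matrix (Fin 2) (Fin 2) ℂ} (hY : Y.PosDef) (n : Fin 4 → ℤ) (x : Fin 4 → ℝ) :
    twist f T (hermCoord m (x + fun i => (n i : ℝ)) + Complex.I • Y)
      = twist f T (hermCoord m x + Complex.I • Y) := by
  rw [hermCoord_add, add_right_comm]
  exact twist_add hm hf hT (mem_integralHerm_iff.mpr ⟨n, rfl⟩) (hermCoord_add_mem_halfSpace m x hY)

/-- The Fourier coefficient can be computed at every height. -/
theorem integral_twist_eq_fourierCoefficient {m : ℕ} (hm : 0 < m)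
    {f : Matrix (Fin 2) (Fin 2) ℂ → ℂ} (hd : DifferentiableOn ℂ f halfSpace)
    (hf : ∀ S ∈ integralHerm m, ∀ Z ∈ halfSpace, f (Z + S) = f Z)
    {T : Matrix (Fin 2) (Fin 2) ℂ} (hT : T ∈ fourierLattice m)
    {Y : Matrix (Fin 2) (Fin 2) ℂ} (hY : Y.PosDef) :
    ∫ x in Set.Icc (0 : Fin 4 → ℝ) 1, twist f T (hermCoord m x + Complex.I • Y)
      = fourierCoefficient m f T := by
  have hB : (Y - 1)ᴴ = Y - 1 := by rw [conjTranspose_sub, hY.1, conjTranspose_one]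
  have hfc := continuousOn_of_differentiableOn hd
  let U := lineDomain 0 1 (Y - 1)
  have hU : IsOpen U := isOpen_lineDomain _ _ _
  have hUx : ∀ s ∈ U, ∀ x,
      hermCoord m x + Complex.I • (1 : Matrix (Fin 2) (Fin 2) ℂ) + s • (Y - 1) ∈ halfSpace := by
    intro s hs x
    exact (mem_lineDomain (hermCoord_conjTranspose m x) conjTranspose_one hB).mpr
      ((mem_lineDomain conjTranspose_zero conjTranspose_one hB).mp hs)
  have h0 : (0 : ℂ) ∈ U := by
    refine (mem_lineDomain conjTranspose_zero conjTranspose_one hB).mpr ?_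
    simpa using PosDef.one
  have hI : Complex.I ∈ U := by
    refine (mem_lineDomain conjTranspose_zero conjTranspose_one hB).mpr ?_
    simpa using hY
  -- `Φ` is holomorphic in `s` and constant on the reals by periodicity, so it takes the same value
  -- at `s = I`, where the height is `Y`.
  let Φ : ℂ → ℂ := fun s => ∫ x in Set.Icc (0 : Fin 4 → ℝ) 1,
    twist f T (hermCoord m x + Complex.I • (1 : Matrix (Fin 2) (Fin 2) ℂ) + s • (Y - 1))
  have hΦ : DifferentiableOn ℂ Φ U := by
    refine differentiableOn_setIntegral isCompact_Icc hU ?_ fun x => ?_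
    · have hc : Continuous fun p : ℂ × (Fin 4 → ℝ) => hermCoord m p.2
          + Complex.I • (1 : Matrix (Fin 2) (Fin 2) ℂ) + p.1 • (Y - 1) := by
        have := continuous_hermCoord m
        fun_prop
      exact (continuousOn_twist hfc T).comp hc.continuousOn fun p hp => hUx p.1 hp.1 p.2
    · exact differentiableOn_twist_line hd T _ _ fun s hs => hUx s hs x
  have hreal : ∀ s : ℝ, Φ s = fourierCoefficient m f T := by
    intro s
    obtain ⟨v, hv⟩ := exists_hermCoord_eq hm hB
    have := setIntegral_periodic_add (continuous_twist_hermCoord (m := m) hfc T PosDef.one)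
      (twist_hermCoord_periodic hm hf hT PosDef.one) (s • v)
    rw [show fourierCoefficient m f T = ∫ x in Set.Icc (0 : Fin 4 → ℝ) 1,
      twist f T (hermCoord m x + Complex.I • (1 : Matrix (Fin 2) (Fin 2) ℂ)) from rfl, ← this]
    simp only [Φ]
    refine setIntegral_congr_fun measurableSet_Icc fun x _ => ?_
    simp only [hermCoord_add, hermCoord_smul, ← hv]
    rw [add_right_comm]
  have key := eq_zero_of_eq_zero_on_reals hU
    (convex_lineDomain conjTranspose_zero conjTranspose_one hB) h0
    (F := fun s => Φ s - fourierCoefficient m f T) (hΦ.sub_const _)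
    (fun s => sub_eq_zero.mpr (hreal s)) Complex.I hI
  rw [← sub_eq_zero.mp key]
  simp only [Φ]
  refine setIntegral_congr_fun measurableSet_Icc fun x _ => ?_
  simp only [smul_sub]
  congr 1
  abel

/-- The map $X\mapsto AX\overline{A}^{tr}$ is real linear, so its values on the lattice basis are
the columns of its coordinate matrix. -/
theorem exists_integral_matrix {m : ℕ} {A : Matrix (Fin 2) (Fin 2) ℂ}
    (hA : ∀ S ∈ integralHerm m, A * S * Aᴴ ∈ integralHerm m) :
    ∃ M : Matrix (Fin 4) (Fin 4) ℤ, ∀ x : Fin 4 → ℝ,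
      A * hermCoord m x * Aᴴ = hermCoord m (M.map (Int.cast : ℤ → ℝ) *ᵥ x) := by
  have hj : ∀ j : Fin 4, ∃ n : Fin 4 → ℤ,
      A * hermCoord m (Pi.single j 1) * Aᴴ = hermCoord m fun i => (n i : ℝ) := fun j => by
    refine mem_integralHerm_iff.mp (hA _ (mem_integralHerm_iff.mpr ⟨Pi.single j 1, ?_⟩))
    congr 1
    funext i
    by_cases hij : i = j
    · subst hij; simp
    · simp [hij]
  choose n hn using hj
  refine ⟨Matrix.of fun i j => n j i, fun x => ?_⟩
  have e : (Matrix.of fun i j => n j i).map (Int.cast : ℤ → ℝ) *ᵥ x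
      = ∑ j, x j • fun i => (n j i : ℝ) := by
    funext i
    simp [mulVec, dotProduct, mul_comm]
  rw [e, hermCoord_eq_sum, Finset.mul_sum, Finset.sum_mul]
  have hs : ∀ v : Fin 4 → Fin 4 → ℝ, hermCoord m (∑ j, v j) = ∑ j, hermCoord m (v j) := fun v => by
    simp only [Fin.sum_univ_four, hermCoord_add]
  rw [hs]
  refine Finset.sum_congr rfl fun j _ => ?_
  rw [Matrix.mul_smul, Matrix.smul_mul, hn, hermCoord_smul]

theorem hermCoord_injective {m : ℕ} (hm : 0 < m) : Function.Injective (hermCoord m) := by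
  intro x y h
  have h0 := congrFun (congrFun h 0) 0
  have h1 := congrFun (congrFun h 0) 1
  have h3 := congrFun (congrFun h 1) 1
  simp only [hermCoord, of_apply, cons_val', cons_val_zero, cons_val_one,
    cons_val_fin_one] at h0 h1 h3
  have him := congrArg Complex.im h1
  have hre := congrArg Complex.re h1
  simp at him hre
  have h2 : x 2 = y 2 := by
    rcases him with h | h
    · exact h
    · exact absurd h (omega_im_ne_zero hm)
  rw [h2] at hre
  funext i
  fin_cases i
  · exact_mod_cast h0
  · simpa using hre
  · exact h2
  · exact_mod_cast h3

theorem conj_mem_fourierLattice {m : ℕ} (hm : 0 < m) {A T : Matrix (Fin 2) (Fin 2) ℂ}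
    (hA : ∀ S ∈ integralHerm m, A * S * Aᴴ ∈ integralHerm m) (hT : T ∈ fourierLattice m) :
    Aᴴ * T * A ∈ fourierLattice m := by
  rw [mem_fourierLattice_iff_trace hm] at hT ⊢
  refine ⟨?_, fun S hS => ?_⟩
  · simp [conjTranspose_mul, hT.1, mul_assoc]
  · obtain ⟨k, hk⟩ := hT.2 _ (hA S hS)
    refine ⟨k, ?_⟩
    rw [← hk, mul_assoc, mul_assoc, trace_mul_comm]
    simp only [mul_assoc]

/-- The Fourier coefficients of `Z ↦ f (A Z A*)`. -/
theorem fourierCoefficient_conj {m : ℕ} (hm : 0 < m)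
    {f : Matrix (Fin 2) (Fin 2) ℂ → ℂ} (hd : DifferentiableOn ℂ f halfSpace)
    (hf : ∀ S ∈ integralHerm m, ∀ Z ∈ halfSpace, f (Z + S) = f Z)
    {A B : Matrix (Fin 2) (Fin 2) ℂ} (hAB : A * B = 1)
    (hA : ∀ S ∈ integralHerm m, A * S * Aᴴ ∈ integralHerm m)
    (hB : ∀ S ∈ integralHerm m, B * S * Bᴴ ∈ integralHerm m)
    {T : Matrix (Fin 2) (Fin 2) ℂ} (hT : T ∈ fourierLattice m) :
    fourierCoefficient m (fun Z => f (A * Z * Aᴴ)) T = fourierCoefficient m f (Bᴴ * T * B) := by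
  have hBA : B * A = 1 := mul_eq_one_comm.mp hAB
  have hAu : IsUnit A := IsUnit.of_mul_eq_one B hAB
  have hAB' : Aᴴ * Bᴴ = 1 := by rw [← conjTranspose_mul, hBA, conjTranspose_one]
  have hT' := conj_mem_fourierLattice hm hB hT
  -- The substitution takes $X+iI$ to $AX\overline{A}^{tr}+iA\overline{A}^{tr}$, so the coefficient
  -- on the right is evaluated at the height $A\overline{A}^{tr}$.
  have hY : (A * Aᴴ).PosDef := PosDef.mul_conjTranspose_self A (vecMul_injective_of_isUnit hAu)
  rw [← integral_twist_eq_fourierCoefficient hm hd hf hT' hY]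
  obtain ⟨M, hM⟩ := exists_integral_matrix hA
  obtain ⟨N, hN⟩ := exists_integral_matrix hB
  have hMN : ∀ x : Fin 4 → ℤ, M *ᵥ (N *ᵥ x) = x := by
    intro x
    have hcast : ∀ (M : Matrix (Fin 4) (Fin 4) ℤ) (x : Fin 4 → ℤ),
        M.map (Int.cast : ℤ → ℝ) *ᵥ (fun i => (x i : ℝ)) = fun i => ((M *ᵥ x) i : ℝ) := by
      intro M x
      funext i
      simp [mulVec, dotProduct]
    have h := hM (N.map (Int.cast : ℤ → ℝ) *ᵥ (fun i => (x i : ℝ)))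
    rw [← hN] at h
    have e : A * (B * hermCoord m (fun i => (x i : ℝ)) * Bᴴ) * Aᴴ
        = (A * B) * hermCoord m (fun i => (x i : ℝ)) * (A * B)ᴴ := by
      rw [conjTranspose_mul]
      simp only [mul_assoc]
    rw [e, hAB, one_mul, conjTranspose_one, mul_one, hcast, hcast] at h
    have := hermCoord_injective hm h
    funext i
    exact_mod_cast (congrFun this i).symm
  rw [← setIntegral_periodic_mulVec
    (continuous_twist_hermCoord (m := m) (continuousOn_of_differentiableOn hd) (Bᴴ * T * B) hY)
    (twist_hermCoord_periodic hm hf hT' hY) hMN]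
  refine setIntegral_congr_fun measurableSet_Icc fun x _ => ?_
  simp only [twist]
  have e : hermCoord m (M.map (Int.cast : ℤ → ℝ) *ᵥ x) + Complex.I • (A * Aᴴ)
      = A * (hermCoord m x + Complex.I • (1 : Matrix (Fin 2) (Fin 2) ℂ)) * Aᴴ := by
    rw [mul_add, add_mul, hM, Matrix.mul_smul, mul_one, Matrix.smul_mul]
  rw [e]
  congr 4
  generalize hermCoord m x + Complex.I • (1 : Matrix (Fin 2) (Fin 2) ℂ) = Z
  calc (T * Z).trace = ((Aᴴ * Bᴴ) * (T * ((B * A) * Z))).trace := by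
        rw [hAB', hBA, one_mul, one_mul]
    _ = (Aᴴ * (Bᴴ * (T * (B * (A * Z))))).trace := by simp only [mul_assoc]
    _ = ((Bᴴ * (T * (B * (A * Z)))) * Aᴴ).trace := trace_mul_comm _ _
    _ = _ := by simp only [mul_assoc]

/-- Invariance under `Z ↦ A Z A*` in terms of the Fourier coefficients. -/
theorem invariant_iff_fourierCoefficient {m : ℕ} (hm : 0 < m)
    {f : Matrix (Fin 2) (Fin 2) ℂ → ℂ} (hd : DifferentiableOn ℂ f halfSpace)
    (hf : ∀ S ∈ integralHerm m, ∀ Z ∈ halfSpace, f (Z + S) = f Z)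
    {A B : Matrix (Fin 2) (Fin 2) ℂ} (hAB : A * B = 1)
    (hA : ∀ S ∈ integralHerm m, A * S * Aᴴ ∈ integralHerm m)
    (hB : ∀ S ∈ integralHerm m, B * S * Bᴴ ∈ integralHerm m) :
    (∀ Z ∈ halfSpace, f (A * Z * Aᴴ) = f Z) ↔
      ∀ T ∈ fourierLattice m, fourierCoefficient m f (Bᴴ * T * B) = fourierCoefficient m f T := by
  have hAu : IsUnit A := IsUnit.of_mul_eq_one B hAB
  have hconj := fun T => fourierCoefficient_conj hm hd hf hAB hA hB (T := T)
  have hfc := continuousOn_of_differentiableOn hd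
  constructor
  · intro h T hT
    rw [← hconj T hT]
    refine setIntegral_congr_fun measurableSet_Icc fun x _ => ?_
    simp only
    rw [h _ (hermCoord_add_mem_halfSpace m x PosDef.one)]
  · intro h
    have hreal : ∀ X : Matrix (Fin 2) (Fin 2) ℂ, Xᴴ = X →
        f (A * (X + Complex.I • (1 : Matrix (Fin 2) (Fin 2) ℂ)) * Aᴴ)
          - f (X + Complex.I • (1 : Matrix (Fin 2) (Fin 2) ℂ)) = 0 := by
      intro X hX
      obtain ⟨x, rfl⟩ := exists_hermCoord_eq hm hX
      have hc1 : Continuous fun x =>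
          f (hermCoord m x + Complex.I • (1 : Matrix (Fin 2) (Fin 2) ℂ)) :=
        hfc.comp_continuous ((continuous_hermCoord m).add continuous_const)
          fun x => hermCoord_add_mem_halfSpace m x PosDef.one
      have hc2 : Continuous fun x =>
          f (A * (hermCoord m x + Complex.I • (1 : Matrix (Fin 2) (Fin 2) ℂ)) * Aᴴ) :=
        hfc.comp_continuous ((continuous_const.matrix_mul
          ((continuous_hermCoord m).add continuous_const)).matrix_mul continuous_const)
          fun x => conj_mem_halfSpace hAu (hermCoord_add_mem_halfSpace m x PosDef.one)
      refine periodic_eq_zero_of_fourier (P := fun x =>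
        f (A * (hermCoord m x + Complex.I • (1 : Matrix (Fin 2) (Fin 2) ℂ)) * Aᴴ)
          - f (hermCoord m x + Complex.I • (1 : Matrix (Fin 2) (Fin 2) ℂ)))
        (hc2.sub hc1) (fun n x => ?_) (fun n => ?_) x
      · have hS : hermCoord m (fun i => (n i : ℝ)) ∈ integralHerm m :=
          mem_integralHerm_iff.mpr ⟨n, rfl⟩
        have hZ := hermCoord_add_mem_halfSpace m x PosDef.one
        rw [hermCoord_add, add_right_comm, hf _ hS _ hZ, mul_add, add_mul,
          hf _ (hA _ hS) _ (conj_mem_halfSpace hAu hZ)]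
      · have hT : dualCoord m n ∈ fourierLattice m := mem_fourierLattice_iff.mpr ⟨n, rfl⟩
        have h1 := hconj _ hT
        rw [h _ hT] at h1
        -- The constant `c` cancels the contribution of the height $I$ to the exponential, turning
        -- Fourier coefficients of the form into those of a periodic function of `x`.
        let c : ℂ := Complex.exp (2 * Real.pi * Complex.I *
          (dualCoord m n * (Complex.I • (1 : Matrix (Fin 2) (Fin 2) ℂ))).trace)
        have he : ∀ x : Fin 4 → ℝ,
            Complex.exp (-(2 * Real.pi * Complex.I * ∑ i, (n i : ℂ) * x i))
            = c * Complex.exp (-(2 * Real.pi * Complex.I * (dualCoord m n *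
              (hermCoord m x + Complex.I • (1 : Matrix (Fin 2) (Fin 2) ℂ))).trace)) := by
          intro x
          rw [← Complex.exp_add, mul_add, trace_add, trace_dualCoord_mul hm]
          congr 1
          ring
        have hexp : Continuous fun x : Fin 4 → ℝ =>
            Complex.exp (-(2 * Real.pi * Complex.I * (dualCoord m n *
              (hermCoord m x + Complex.I • (1 : Matrix (Fin 2) (Fin 2) ℂ))).trace)) := by
          have : Continuous fun x : Fin 4 → ℝ => (dualCoord m n *
              (hermCoord m x + Complex.I • (1 : Matrix (Fin 2) (Fin 2) ℂ))).trace :=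
            (continuous_const.matrix_mul
              ((continuous_hermCoord m).add continuous_const)).matrix_trace
          fun_prop
        have hi2 := (hc2.mul hexp).continuousOn.integrableOn_compact (μ := volume)
          (isCompact_Icc (a := (0 : Fin 4 → ℝ)) (b := 1))
        have hi1 := (hc1.mul hexp).continuousOn.integrableOn_compact (μ := volume)
          (isCompact_Icc (a := (0 : Fin 4 → ℝ)) (b := 1))
        simp only [he]
        have hsub := integral_sub hi2 hi1
        simp only [Pi.mul_apply] at hsub
        have h2 : fourierCoefficient m (fun Z => f (A * Z * Aᴴ)) (dualCoord m n)
          - fourierCoefficient m f (dualCoord m n) = 0 := sub_eq_zero.mpr h1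
        rw [fourierCoefficient, fourierCoefficient, ← hsub] at h2
        rw [← mul_zero c, ← h2, ← integral_const_mul]
        refine setIntegral_congr_fun measurableSet_Icc fun x _ => ?_
        ring
    -- So far equality is known only at height $I$; holomorphy on the line towards `Z` gives the
    -- rest.
    intro Z hZ
    obtain ⟨X, hX, hXY⟩ := exists_herm_decomposition Z
    set Y := (1 / (2 * Complex.I)) • (Z - Zᴴ) with hYdef
    have hY : Y.PosDef := hZ
    have hB1 : (Y - 1)ᴴ = Y - 1 := by rw [conjTranspose_sub, hY.1, conjTranspose_one]
    have hmem := fun s => mem_lineDomain (s := s) hX conjTranspose_one hB1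
    have h0 : (0 : ℂ) ∈ lineDomain X 1 (Y - 1) := (hmem 0).mpr (by simpa using PosDef.one)
    have hI : Complex.I ∈ lineDomain X 1 (Y - 1) := (hmem _).mpr (by simpa using hY)
    have hdiff : DifferentiableOn ℂ (fun s : ℂ =>
        f (A * (X + Complex.I • (1 : Matrix (Fin 2) (Fin 2) ℂ) + s • (Y - 1)) * Aᴴ)
          - f (X + Complex.I • (1 : Matrix (Fin 2) (Fin 2) ℂ) + s • (Y - 1)))
        (lineDomain X 1 (Y - 1)) := by
      refine DifferentiableOn.sub ?_ (differentiableOn_line hd _ _ fun s hs => hs)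
      have e : ∀ s : ℂ, A * (X + Complex.I • (1 : Matrix (Fin 2) (Fin 2) ℂ) + s • (Y - 1)) * Aᴴ
          = A * (X + Complex.I • (1 : Matrix (Fin 2) (Fin 2) ℂ)) * Aᴴ
            + s • (A * (Y - 1) * Aᴴ) := fun s => by
        rw [mul_add, add_mul, Matrix.mul_smul, Matrix.smul_mul]
      have h3 := differentiableOn_line hd
        (A * (X + Complex.I • (1 : Matrix (Fin 2) (Fin 2) ℂ)) * Aᴴ) (A * (Y - 1) * Aᴴ)
        (U := lineDomain X 1 (Y - 1)) fun s hs => by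
          rw [← e]
          exact conj_mem_halfSpace hAu hs
      simpa only [e] using h3
    have key := eq_zero_of_eq_zero_on_reals (isOpen_lineDomain _ _ _)
      (convex_lineDomain hX conjTranspose_one hB1) h0 hdiff (fun s => ?_) _ hI
    · have e : X + Complex.I • (1 : Matrix (Fin 2) (Fin 2) ℂ) + Complex.I • (Y - 1) = Z := by
        conv_rhs => rw [hXY]
        rw [smul_sub]
        abel
      simp only [e] at key
      exact sub_eq_zero.mp key
    · have h4 := hreal (X + (s : ℂ) • (Y - 1)) (by simp [hX, hB1])
      simpa only [add_right_comm] using h4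

/-! ### Admissible matrices -/

/-- The matrices of determinant one for which all the products of an entry with a conjugate of an
entry are integral. -/
def IsAdmissible (m : ℕ) (A : Matrix (Fin 2) (Fin 2) ℂ) : Prop :=
  A.det = 1 ∧ ∀ i j k l, A i j * star (A k l) ∈ ringInt m

theorem isAdmissible_of_integral {m : ℕ} {U : Matrix (Fin 2) (Fin 2) ℂ} (hU : U.det = 1)
    (hO : ∀ i j, U i j ∈ ringInt m) : IsAdmissible m U :=
  ⟨hU, fun i j k l => mul_mem (hO i j) (star_mem_ringInt (hO k l))⟩

namespace IsAdmissible

variable {m : ℕ} {A : Matrix (Fin 2) (Fin 2) ℂ}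

theorem adjugate (hA : IsAdmissible m A) : IsAdmissible m A.adjugate := by
  refine ⟨by rw [det_adjugate, hA.1, one_pow], fun i j k l => ?_⟩
  rw [adjugate_fin_two]
  fin_cases i <;> fin_cases j <;> fin_cases k <;> fin_cases l <;> simp <;> exact hA.2 _ _ _ _

theorem mul_adjugate (hA : IsAdmissible m A) : A * A.adjugate = 1 := by
  rw [Matrix.mul_adjugate, hA.1, one_smul]

theorem conj_mem (hA : IsAdmissible m A) {S : Matrix (Fin 2) (Fin 2) ℂ}
    (hS : S ∈ integralHerm m) : A * S * Aᴴ ∈ integralHerm m := by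
  refine ⟨by simp [conjTranspose_mul, hS.1, mul_assoc], fun i j => ?_⟩
  rw [mul_apply]
  refine sum_mem fun k _ => ?_
  rw [mul_apply, Finset.sum_mul]
  refine sum_mem fun l _ => ?_
  rw [conjTranspose_apply, mul_right_comm]
  exact mul_mem (hA.2 _ _ _ _) (hS.2 _ _)

theorem conj_mem_fourierLattice (hm : 0 < m) (hA : IsAdmissible m A)
    {T : Matrix (Fin 2) (Fin 2) ℂ} (hT : T ∈ fourierLattice m) : Aᴴ * T * A ∈ fourierLattice m :=
  HermitianMaass.conj_mem_fourierLattice hm (fun _ => hA.conj_mem) hT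

theorem adjugate_conj_conj (hA : IsAdmissible m A) (T : Matrix (Fin 2) (Fin 2) ℂ) :
    A.adjugateᴴ * (Aᴴ * T * A) * A.adjugate = T := by
  calc A.adjugateᴴ * (Aᴴ * T * A) * A.adjugate
      = (A * A.adjugate)ᴴ * T * (A * A.adjugate) := by
        rw [conjTranspose_mul]
        simp only [mul_assoc]
    _ = T := by rw [hA.mul_adjugate, conjTranspose_one, one_mul, mul_one]

theorem conj_mem_fourierLattice_iff (hm : 0 < m) (hA : IsAdmissible m A)
    {T : Matrix (Fin 2) (Fin 2) ℂ} : Aᴴ * T * A ∈ fourierLattice m ↔ T ∈ fourierLattice m := by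
  refine ⟨fun h => ?_, hA.conj_mem_fourierLattice hm⟩
  have := hA.adjugate.conj_mem_fourierLattice hm h
  rwa [hA.adjugate_conj_conj] at this

/-- Conjugation by `A` preserves membership in $\Lambda$ in both directions and commutes with
scaling, so both suprema are over the same set. -/
theorem content_conj (hm : 0 < m) (hA : IsAdmissible m A) (T : Matrix (Fin 2) (Fin 2) ℂ) :
    content m (Aᴴ * T * A) = content m T := by
  unfold content
  congr 1
  ext q
  have e : (1 / (q : ℂ)) • (Aᴴ * T * A) = Aᴴ * ((1 / (q : ℂ)) • T) * A := by
    rw [Matrix.mul_smul, Matrix.smul_mul]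
  simp only [Set.mem_ofPred_eq, e, hA.conj_mem_fourierLattice_iff hm]

theorem det_conj (hA : IsAdmissible m A) (T : Matrix (Fin 2) (Fin 2) ℂ) :
    (Aᴴ * T * A).det = T.det := by
  rw [det_mul, det_mul, det_conjTranspose, hA.1]
  simp

theorem posSemidef_conj_iff (hA : IsAdmissible m A) {T : Matrix (Fin 2) (Fin 2) ℂ} :
    (Aᴴ * T * A).PosSemidef ↔ T.PosSemidef := by
  refine ⟨fun h => ?_, fun h => h.conjTranspose_mul_mul_same A⟩
  have := h.conjTranspose_mul_mul_same A.adjugate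
  rwa [hA.adjugate_conj_conj] at this

theorem conj_ne_zero (hA : IsAdmissible m A) {T : Matrix (Fin 2) (Fin 2) ℂ} (hT : T ≠ 0) :
    Aᴴ * T * A ≠ 0 := fun h => hT (by
  have := hA.adjugate_conj_conj T
  rw [h] at this
  simpa using this.symm)

/-- Invariance of a modular form under `Z ↦ A Z A*` in terms of its Fourier coefficients. -/
theorem invariant_iff (hm : 0 < m) {r : ℤ} {f : Matrix (Fin 2) (Fin 2) ℂ → ℂ}
    (hf : f ∈ modularForms (modularGroup m) r) (hA : IsAdmissible m A) :
    (∀ Z ∈ halfSpace, f (A * Z * Aᴴ) = f Z) ↔ ∀ T ∈ fourierLattice m,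
      fourierCoefficient m f (Aᴴ * T * A) = fourierCoefficient m f T := by
  rw [invariant_iff_fourierCoefficient hm hf.1 (fun S hS Z hZ => modularForm_add hf hS hZ)
    hA.mul_adjugate (fun _ => hA.conj_mem) (fun _ => hA.adjugate.conj_mem)]
  constructor
  · intro h T hT
    rw [← h _ (hA.conj_mem_fourierLattice hm hT), hA.adjugate_conj_conj]
  · intro h T hT
    have e := hA.adjugate.adjugate_conj_conj T
    rw [adjugate_adjugate' , Fintype.card_fin, hA.1] at e
    rw [← h _ (hA.adjugate.conj_mem_fourierLattice hm hT)]
    simp only [one_pow, one_smul] at e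
    rw [e]

end IsAdmissible

theorem fourierCoefficient_unimodular {m : ℕ} (hm : 0 < m) {r : ℤ}
    {f : Matrix (Fin 2) (Fin 2) ℂ → ℂ} (hf : f ∈ modularForms (modularGroup m) r)
    {U : Matrix (Fin 2) (Fin 2) ℂ} (hU : U.det = 1) (hO : ∀ i j, U i j ∈ ringInt m)
    {T : Matrix (Fin 2) (Fin 2) ℂ} (hT : T ∈ fourierLattice m) :
    fourierCoefficient m f (Uᴴ * T * U) = fourierCoefficient m f T :=
  ((isAdmissible_of_integral hU hO).invariant_iff hm hf).mp
    (fun _ hZ => modularForm_unimodular hf hU hO hZ) T hT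

/-! ### The Koecher principle -/

theorem exists_fourierCoefficient_bound {m : ℕ} (hm : 0 < m) {f : Matrix (Fin 2) (Fin 2) ℂ → ℂ}
    (hf : ContinuousOn f halfSpace) : ∃ C : ℝ, ∀ T ∈ fourierLattice m,
      ‖fourierCoefficient m f T‖ ≤ C * Real.exp (2 * Real.pi * T.trace.re) := by
  have hc : Continuous fun x =>
      f (hermCoord m x + Complex.I • (1 : Matrix (Fin 2) (Fin 2) ℂ)) :=
    hf.comp_continuous ((continuous_hermCoord m).add continuous_const)
      fun x => hermCoord_add_mem_halfSpace m x PosDef.one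
  obtain ⟨C, hC⟩ := (isCompact_Icc (a := (0 : Fin 4 → ℝ)) (b := 1)).exists_bound_of_continuousOn
    hc.continuousOn
  refine ⟨C, fun T hT => ?_⟩
  have hvol : volume (Set.Icc (0 : Fin 4 → ℝ) 1) = 1 := by
    simp [Real.volume_Icc_pi]
  have hb := norm_setIntegral_le_of_norm_le_const (μ := volume) (s := Set.Icc (0 : Fin 4 → ℝ) 1)
    (f := fun x => f (hermCoord m x + Complex.I • (1 : Matrix (Fin 2) (Fin 2) ℂ)) *
      Complex.exp (-(2 * Real.pi * Complex.I *
        (T * (hermCoord m x + Complex.I • (1 : Matrix (Fin 2) (Fin 2) ℂ))).trace)))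
    (C := C * Real.exp (2 * Real.pi * T.trace.re)) (by rw [hvol]; exact ENNReal.one_lt_top) ?_
  · rw [Measure.real, hvol, ENNReal.toReal_one, mul_one] at hb
    exact hb
  · intro x hx
    rw [norm_mul, Complex.norm_exp]
    refine mul_le_mul (hC x hx) (le_of_eq ?_) (Real.exp_pos _).le ((norm_nonneg _).trans (hC x hx))
    congr 1
    obtain ⟨n, rfl⟩ := mem_fourierLattice_iff.mp hT
    rw [mul_add, trace_add, trace_dualCoord_mul hm, Matrix.mul_smul, mul_one, trace_smul]
    have him : (∑ i, (n i : ℂ) * x i).im = 0 := by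
      simp [Fin.sum_univ_four]
    simp [him, Complex.mul_re]

/-- Unipotent substitutions `U n` do not change the coefficient, while the trace of the transformed
matrix is a quadratic polynomial in `n` with leading coefficient `(T 0 0).re < 0`. The bound by $C
e^{2\pi\,\mathrm{tr}}$ therefore tends to zero. -/
theorem fourierCoefficient_eq_zero_of_neg {m : ℕ} (hm : 0 < m) {r : ℤ}
    {f : Matrix (Fin 2) (Fin 2) ℂ → ℂ} (hf : f ∈ modularForms (modularGroup m) r)
    {T : Matrix (Fin 2) (Fin 2) ℂ} (hT : T ∈ fourierLattice m) (hneg : (T 0 0).re < 0) :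
    fourierCoefficient m f T = 0 := by
  obtain ⟨C, hC⟩ := exists_fourierCoefficient_bound hm (continuousOn_of_differentiableOn hf.1)
  let U : ℕ → Matrix (Fin 2) (Fin 2) ℂ := fun n => !![1, (n : ℂ); 0, 1]
  have hU : ∀ n, (U n).det = 1 := fun n => by simp [U]
  have hO : ∀ n i j, U n i j ∈ ringInt m := fun n i j => by
    fin_cases i <;> fin_cases j <;> simp [U]
  have htr : ∀ n, ((U n)ᴴ * T * U n).trace.re
      = (T 0 0).re * (n * n) + (2 * (T 0 1).re) * n + T.trace.re := fun n => by
    have h10 : T 1 0 = star (T 0 1) := (congrFun (congrFun hT.1 1) 0).symm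
    rw [trace_fin_two, trace_fin_two]
    simp [U, mul_apply, Fin.sum_univ_two, h10]
    ring
  have hle : ∀ n : ℕ, ‖fourierCoefficient m f T‖ ≤ C * Real.exp (2 * Real.pi *
      ((T 0 0).re * (n * n) + (2 * (T 0 1).re) * n + T.trace.re)) := fun n => by
    have h1 := hC _ ((isAdmissible_of_integral (hU n) (hO n)).conj_mem_fourierLattice hm hT)
    rwa [fourierCoefficient_unimodular hm hf (hU n) (hO n) hT, htr] at h1
  have hlim : Filter.Tendsto (fun n : ℕ => C * Real.exp (2 * Real.pi *
      ((T 0 0).re * (n * n) + (2 * (T 0 1).re) * n + T.trace.re))) Filter.atTop (nhds (C * 0)) := by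
    refine Filter.Tendsto.const_mul C (Real.tendsto_exp_atBot.comp
      (Filter.Tendsto.const_mul_atBot (by positivity) ?_))
    refine Filter.tendsto_atBot_add_const_right _ _ ?_
    have e : (fun n : ℕ => (T 0 0).re * ((n : ℝ) * n) + (2 * (T 0 1).re) * n)
        = fun n : ℕ => (n : ℝ) * ((T 0 0).re * n + 2 * (T 0 1).re) := by
      funext n
      ring
    rw [e]
    refine Filter.Tendsto.atTop_mul_atBot₀ tendsto_natCast_atTop_atTop ?_
    exact Filter.tendsto_atBot_add_const_right _ _
      (tendsto_natCast_atTop_atTop.const_mul_atTop_of_neg hneg)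
  have h0 := ge_of_tendsto' hlim hle
  rw [mul_zero] at h0
  exact norm_le_zero_iff.mp h0

/-- Ratios of this shape are dense and have numerator and denominator visibly coprime in
$\mathcal{O}$, so they can be completed to unimodular matrices whatever the class number. -/
theorem exists_dyadic_tendsto {m : ℕ} (hm : 0 < m) (z : ℂ) :
    ∃ β : ℕ → ringInt m,
      Filter.Tendsto (fun k : ℕ => (1 + 2 * (β k : ℂ)) / 2 ^ k) Filter.atTop (nhds z) := by
  have ho := omega_im_ne_zero hm
  let y : ℝ := z.im / (omega m).im
  let x : ℝ := z.re - y * (omega m).re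
  have hz : z = x + y * omega m := by
    apply Complex.ext
    · simp [x]
    · simp [y]
      field_simp
  let a : ℕ → ℤ := fun k => ⌊2 ^ k * x / 2⌋
  let b : ℕ → ℤ := fun k => ⌊2 ^ k * y / 2⌋
  refine ⟨fun k => ⟨a k + b k * omega m, a k, b k, rfl⟩, ?_⟩
  rw [tendsto_iff_norm_sub_tendsto_zero]
  have hbound : ∀ k : ℕ, ‖(1 + 2 * ((a k : ℂ) + b k * omega m)) / 2 ^ k - z‖
      ≤ (3 + 2 * ‖omega m‖) * (1 / 2) ^ k := by
    intro k
    have h2 : (2 : ℂ) ^ k ≠ 0 := pow_ne_zero _ two_ne_zero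
    have e : (1 + 2 * ((a k : ℂ) + b k * omega m)) / 2 ^ k - z
        = (1 - 2 * ((Int.fract (2 ^ k * x / 2) : ℝ) : ℂ)
          - 2 * ((Int.fract (2 ^ k * y / 2) : ℝ) : ℂ) * omega m) * (1 / 2) ^ k := by
      rw [← Int.self_sub_floor, ← Int.self_sub_floor]
      simp only [a, b]
      push_cast
      rw [one_div, inv_pow]
      field_simp
      rw [hz]
      ring
    rw [e, norm_mul, norm_pow]
    have h12 : ‖(1 / 2 : ℂ)‖ = 1 / 2 := by simp
    rw [h12]
    refine mul_le_mul_of_nonneg_right ?_ (by positivity)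
    refine (norm_sub_le _ _).trans (add_le_add ((norm_sub_le _ _).trans ?_) ?_)
    · rw [norm_mul, Complex.norm_real, Real.norm_of_nonneg (Int.fract_nonneg _)]
      have := (Int.fract_lt_one (2 ^ k * x / 2)).le
      simp
      linarith
    · rw [norm_mul, norm_mul, Complex.norm_real, Real.norm_of_nonneg (Int.fract_nonneg _)]
      have := (Int.fract_lt_one (2 ^ k * y / 2)).le
      refine mul_le_mul_of_nonneg_right ?_ (norm_nonneg _)
      simp
      linarith
  refine squeeze_zero (fun k => norm_nonneg _) hbound ?_
  have := (tendsto_pow_atTop_nhds_zero_of_lt_one (by norm_num : (0 : ℝ) ≤ 1 / 2)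
    (by norm_num)).const_mul (3 + 2 * ‖omega m‖)
  rwa [mul_zero] at this

/-- A Hermitian form that takes a negative value takes one at the first column of a unimodular
matrix. -/
theorem exists_unimodular_neg {m : ℕ} (hm : 0 < m) {T : Matrix (Fin 2) (Fin 2) ℂ} (hT : Tᴴ = T)
    (hneg : ¬ T.PosSemidef) : ∃ U : Matrix (Fin 2) (Fin 2) ℂ, U.det = 1 ∧
      (∀ i j, U i j ∈ ringInt m) ∧ ((Uᴴ * T * U) 0 0).re < 0 := by
  have hcol : ∀ U : Matrix (Fin 2) (Fin 2) ℂ, ((Uᴴ * T * U) 0 0).re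
      = (T 0 0).re * Complex.normSq (U 0 0) + (T 1 1).re * Complex.normSq (U 1 0)
        + 2 * (star (U 0 0) * T 0 1 * U 1 0).re := by
    intro U
    have h := congrArg Complex.re (herm_form hT fun i => U i 0)
    rw [Complex.ofReal_re] at h
    rw [← h]
    simp [mul_apply, dotProduct, mulVec, Fin.sum_univ_two]
    ring
  by_cases h11 : (T 1 1).re < 0
  · refine ⟨!![0, -1; 1, 0], by simp, fun i j => ?_, ?_⟩
    · fin_cases i <;> fin_cases j <;> simp
    · rw [hcol]
      simpa using h11
  obtain ⟨v, hv⟩ : ∃ v : Fin 2 → ℂ, (T 0 0).re * Complex.normSq (v 0)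
      + (T 1 1).re * Complex.normSq (v 1) + 2 * (star (v 0) * T 0 1 * v 1).re < 0 := by
    by_contra! hcon
    refine hneg (PosSemidef.of_dotProduct_mulVec_nonneg hT fun x => ?_)
    rw [herm_form hT]
    exact_mod_cast hcon x
  have hv0 : v 0 ≠ 0 := by
    intro h0
    rw [h0] at hv
    simp at hv
    have := mul_nonneg (not_lt.mp h11) (Complex.normSq_nonneg (v 1))
    linarith
  -- Up to a nonnegative factor the form depends only on the ratio of the coordinates. Negativity is
  -- an open condition on that ratio and so passes to a dyadic approximation.
  let q : ℂ → ℝ := fun z => (T 0 0).re + (T 1 1).re * Complex.normSq z + 2 * (T 0 1 * z).re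
  have hscale : ∀ x z : ℂ, (T 0 0).re * Complex.normSq x
      + (T 1 1).re * Complex.normSq (x * z) + 2 * (star x * T 0 1 * (x * z)).re
      = Complex.normSq x * q z := by
    intro x z
    simp [q, Complex.normSq_apply]
    ring
  have hqz : q (v 1 / v 0) < 0 := by
    have h := hscale (v 0) (v 1 / v 0)
    rw [mul_div_cancel₀ _ hv0] at h
    rw [h] at hv
    exact neg_of_mul_neg_right hv (Complex.normSq_nonneg _)
  have hqc : Continuous q := by
    have := Complex.continuous_normSq
    fun_prop
  obtain ⟨β, hβ⟩ := exists_dyadic_tendsto hm (v 1 / v 0)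
  obtain ⟨k, hk⟩ := (((hqc.tendsto _).comp hβ).eventually_lt_const hqz).exists
  -- The relation $(1+2\beta)-2\beta=1$ gives coprimality to $2$, hence to its powers; the Bézout
  -- coefficients become the second column.
  have hcop : IsCoprime ((2 : ringInt m) ^ k) (1 + 2 * β k) :=
    IsCoprime.pow_left ⟨-β k, 1, by ring⟩
  obtain ⟨a, b, hab⟩ := hcop
  have hab' : (a : ℂ) * 2 ^ k + b * (1 + 2 * β k) = 1 := by
    have h2 : ((2 : ringInt m) : ℂ) = 2 := rfl
    have := congrArg (fun x : ringInt m => (x : ℂ)) hab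
    simpa [h2] using this
  refine ⟨!![2 ^ k, -(b : ℂ); 1 + 2 * (β k : ℂ), (a : ℂ)], ?_, fun i j => ?_, ?_⟩
  · rw [det_fin_two_of]
    linear_combination hab'
  · have h2 : (2 : ℂ) ^ k ∈ ringInt m := pow_mem (by exact_mod_cast intCast_mem_ringInt m 2) k
    have h3 : 1 + 2 * (β k : ℂ) ∈ ringInt m :=
      add_mem (one_mem _) (mul_mem (by exact_mod_cast intCast_mem_ringInt m 2) (β k).2)
    fin_cases i <;> fin_cases j
    · exact h2
    · exact neg_mem b.2
    · exact h3
    · exact a.2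
  · rw [hcol]
    have h2 : (2 : ℂ) ^ k ≠ 0 := pow_ne_zero _ two_ne_zero
    have h := hscale (2 ^ k) ((1 + 2 * (β k : ℂ)) / 2 ^ k)
    rw [mul_div_cancel₀ _ h2] at h
    simp only [of_apply, cons_val', cons_val_zero, cons_val_one, cons_val_fin_one]
    rw [h]
    exact mul_neg_of_pos_of_neg (Complex.normSq_pos.mpr h2) hk

/-- The Koecher principle: the Fourier coefficients are supported on the positive semidefinite
matrices. -/
theorem fourierCoefficient_eq_zero_of_not_posSemidef {m : ℕ} (hm : 0 < m) {r : ℤ}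
    {f : Matrix (Fin 2) (Fin 2) ℂ → ℂ} (hf : f ∈ modularForms (modularGroup m) r)
    {T : Matrix (Fin 2) (Fin 2) ℂ} (hT : T ∈ fourierLattice m) (hneg : ¬ T.PosSemidef) :
    fourierCoefficient m f T = 0 := by
  obtain ⟨U, hU, hO, h⟩ := exists_unimodular_neg hm hT.1 hneg
  rw [← fourierCoefficient_unimodular hm hf hU hO hT]
  exact fourierCoefficient_eq_zero_of_neg hm hf
    ((isAdmissible_of_integral hU hO).conj_mem_fourierLattice hm hT) h

/-! ### Arithmetic in the ring of integers -/

/-- After removing the common factor of $n$ and $y$, the square of the rest of $n$ divides the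
squarefree $m$, so that rest is a unit. -/
theorem dvd_of_sq_dvd_squarefree_mul_sq {m n y : ℤ} (hm : Squarefree m) (hn : n ≠ 0)
    (h : n ^ 2 ∣ m * y ^ 2) : n ∣ y := by
  have hg : 0 < Int.gcd n y := Int.gcd_pos_of_ne_zero_left _ hn
  obtain ⟨g, n', y', hg0, hcop, hn', hy'⟩ := Int.exists_gcd_one' hg
  have hgz : ((g : ℤ)) ^ 2 ≠ 0 := by positivity
  rw [hn', hy', mul_pow, mul_pow, ← mul_assoc] at h
  have h1 : n' ^ 2 ∣ m * y' ^ 2 := Int.dvd_of_mul_dvd_mul_right hgz h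
  have h2 : n' ^ 2 ∣ m :=
    (IsCoprime.pow (Int.isCoprime_iff_gcd_eq_one.mpr hcop)).dvd_of_dvd_mul_right h1
  have h3 : IsUnit n' := hm n' (by rwa [← sq])
  rw [hn', hy']
  exact mul_dvd_mul_right (h3.dvd) _

theorem star_sqrtNeg (m : ℕ) : star (sqrtNeg m) = -sqrtNeg m := by
  simp [sqrtNeg]

theorem sqrtNeg_mem_ringInt (m : ℕ) : sqrtNeg m ∈ ringInt m := by
  by_cases h : m % 4 = 3
  · refine ⟨-1, 2, ?_⟩
    simp only [omega, if_pos h]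
    push_cast
    ring
  · exact ⟨0, 1, by simp [omega, h]⟩

/-- A description of $\mathcal{O}$ that treats both shapes of $\omega$ at once: only the parity
condition depends on $m$ modulo $4$. -/
theorem mem_ringInt_iff {m : ℕ} {p : ℂ} : p ∈ ringInt m ↔ ∃ x y : ℤ,
    2 * p = x + y * sqrtNeg m ∧ 2 ∣ x - y ∧ (m % 4 ≠ 3 → 2 ∣ x) := by
  constructor
  · rintro ⟨a, b, rfl⟩
    by_cases h : m % 4 = 3
    · refine ⟨2 * a + b, b, ?_, ⟨a, by ring⟩, fun h' => absurd h h'⟩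
      simp only [omega, if_pos h]
      push_cast
      ring
    · refine ⟨2 * a, 2 * b, ?_, ⟨a - b, by ring⟩, fun _ => ⟨a, rfl⟩⟩
      simp only [omega, if_neg h]
      push_cast
      ring
  · rintro ⟨x, y, hp, ⟨c, hc⟩, hx⟩
    by_cases h : m % 4 = 3
    · refine ⟨c, y, ?_⟩
      have hc' : (x : ℂ) - y = 2 * c := by exact_mod_cast hc
      simp only [omega, if_pos h]
      linear_combination hp / 2 + hc' / 2
    · obtain ⟨a, ha⟩ := hx h
      refine ⟨a, a - c, ?_⟩
      have hc' : (x : ℂ) - y = 2 * c := by exact_mod_cast hc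
      have ha' : (x : ℂ) = 2 * a := by exact_mod_cast ha
      simp only [omega, if_neg h]
      push_cast
      linear_combination hp / 2 + ha' / 2 + (ha' / 2 - hc' / 2) * sqrtNeg m

theorem exists_int_norm {m : ℕ} {p : ℂ} (hp : p ∈ ringInt m) : ∃ n : ℤ, p * star p = n :=
  exists_int_of_mem_ringInt (mul_mem hp (star_mem_ringInt hp)) (by simp; ring)

theorem mod_four_ne_zero {m : ℕ} (hm : Squarefree m) : m % 4 ≠ 0 := by
  intro h
  have := hm 2 (by omega)
  simp at this

theorem squarefree_intCast {m : ℕ} (hm : Squarefree m) : Squarefree (m : ℤ) :=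
  Int.squarefree_natCast.mpr hm

/-- An element whose trace is divisible by `n` and whose norm is divisible by `n²` is divisible by
`n`. -/
theorem div_mem_ringInt {m : ℕ} (hm : Squarefree m) {p : ℂ} (hp : p ∈ ringInt m) {n k l : ℤ}
    (hn : n ≠ 0) (htr : p + star p = n * k) (hN : p * star p = n ^ 2 * l) :
    p / n ∈ ringInt m := by
  obtain ⟨x, y, hxy, -, -⟩ := mem_ringInt_iff.mp hp
  have hs := sqrtNeg_mul_self m
  have hxy' : 2 * star p = x - y * sqrtNeg m := by
    have := congrArg star hxy
    rw [star_mul', star_add, star_mul', star_sqrtNeg] at this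
    simpa [sub_eq_add_neg] using this
  have hx : x = n * k := by
    have : (x : ℂ) = n * k := by linear_combination htr - hxy / 2 - hxy' / 2
    exact_mod_cast this
  -- From four times the norm of `p`, which is $x^2+my^2$, with $x=nk$.
  have hy : (m : ℤ) * y ^ 2 = n ^ 2 * (4 * l - k ^ 2) := by
    have hx' : (x : ℂ) = n * k := by exact_mod_cast hx
    have : (m : ℂ) * y ^ 2 = n ^ 2 * (4 * l - k ^ 2) := by
      linear_combination 4 * hN - (x + n * k) * hx' + y ^ 2 * hs - 2 * star p * hxy
        - (x + y * sqrtNeg m) * hxy'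
    exact_mod_cast this
  obtain ⟨e, rfl⟩ := dvd_of_sq_dvd_squarefree_mul_sq (squarefree_intCast hm) hn ⟨_, hy⟩
  have he : (m : ℤ) * e ^ 2 = 4 * l - k ^ 2 := by
    have h0 : n ^ 2 ≠ 0 := pow_ne_zero _ hn
    apply mul_left_cancel₀ h0
    linear_combination hy
  have hnC : (n : ℂ) ≠ 0 := by exact_mod_cast hn
  refine mem_ringInt_iff.mpr ⟨k, e, ?_, ?_, ?_⟩
  · rw [hx] at hxy
    push_cast at hxy
    field_simp
    linear_combination hxy
  -- Now $me^2+k^2\equiv0$ mod $4$. Since $4\nmid m$, residues force $e\equiv k$ mod $2$, and both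
  -- even unless $m\equiv3$ mod $4$.
  · rw [← even_iff_two_dvd, Int.even_sub]
    have h4 := mod_four_ne_zero hm
    have hm4 : (m : ℤ) % 4 = 1 ∨ (m : ℤ) % 4 = 2 ∨ (m : ℤ) % 4 = 3 := by omega
    have hmod : ((m : ℤ) * e ^ 2 + k ^ 2) % 4 = 0 := by omega
    rw [Int.add_emod, Int.mul_emod, pow_two, pow_two, Int.mul_emod e, Int.mul_emod k] at hmod
    rw [Int.even_iff, Int.even_iff]
    have he4 : e % 4 = 0 ∨ e % 4 = 1 ∨ e % 4 = 2 ∨ e % 4 = 3 := by omega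
    have hk4 : k % 4 = 0 ∨ k % 4 = 1 ∨ k % 4 = 2 ∨ k % 4 = 3 := by omega
    rcases hm4 with h | h | h <;> rcases he4 with h' | h' | h' | h' <;>
      rcases hk4 with h'' | h'' | h'' | h'' <;> rw [h, h', h''] at hmod <;>
      first
        | (exfalso; revert hmod; decide)
        | omega
  · intro h3
    have h4 := mod_four_ne_zero hm
    have hm4 : (m : ℤ) % 4 = 1 ∨ (m : ℤ) % 4 = 2 := by omega
    have hmod : ((m : ℤ) * e ^ 2 + k ^ 2) % 4 = 0 := by omega
    rw [Int.add_emod, Int.mul_emod, pow_two, pow_two, Int.mul_emod e, Int.mul_emod k] at hmod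
    have he4 : e % 4 = 0 ∨ e % 4 = 1 ∨ e % 4 = 2 ∨ e % 4 = 3 := by omega
    have hk4 : k % 4 = 0 ∨ k % 4 = 1 ∨ k % 4 = 2 ∨ k % 4 = 3 := by omega
    rcases hm4 with h | h <;> rcases he4 with h' | h' | h' | h' <;>
      rcases hk4 with h'' | h'' | h'' | h'' <;> rw [h, h', h''] at hmod <;>
      first
        | (exfalso; revert hmod; decide)
        | omega

/-! ### The matrices of the extension -/

/-- Only one inclusion is a condition: the determinant is a combination of products of two entries
and always lies in the squared ideal. -/
theorem entryIdeal_sq_eq_iff {m : ℕ} {L : Matrix (Fin 2) (Fin 2) (ringInt m)} :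
    entryIdeal L ^ 2 = Ideal.span {L.det} ↔ ∀ i j k l, L.det ∣ L i j * L k l := by
  constructor
  · intro h i j k l
    have : L i j * L k l ∈ entryIdeal L ^ 2 := by
      rw [sq]
      exact Ideal.mul_mem_mul (Ideal.subset_span ⟨i, j, rfl⟩) (Ideal.subset_span ⟨k, l, rfl⟩)
    rwa [h, Ideal.mem_span_singleton] at this
  · intro h
    apply le_antisymm
    · rw [sq, entryIdeal, Ideal.span_mul_span', Ideal.span_le]
      rintro _ ⟨_, ⟨i, j, rfl⟩, _, ⟨k, l, rfl⟩, rfl⟩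
      exact Ideal.mem_span_singleton.mpr (h i j k l)
    · rw [Ideal.span_singleton_le_iff_mem, det_fin_two, sq]
      have hmem : ∀ i j, L i j ∈ entryIdeal L := fun i j => Ideal.subset_span ⟨i, j, rfl⟩
      exact sub_mem (Ideal.mul_mem_mul (hmem _ _) (hmem _ _))
        (Ideal.mul_mem_mul (hmem _ _) (hmem _ _))

theorem sq_dvd_norm {s k n p : ℤ} (hs : Squarefree s) (hk : k ≠ 0)
    (h : n ^ 2 = k ^ 2 * s * p) : s * k ∣ n := by
  obtain ⟨v, rfl⟩ : k ∣ n := (Int.pow_dvd_pow_iff two_ne_zero).mp ⟨s * p, by rw [h]; ring⟩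
  have hv : v ^ 2 = s * p := by
    apply mul_left_cancel₀ (pow_ne_zero 2 hk)
    linear_combination h
  have : s ∣ v := (hs.dvd_pow_iff_dvd two_ne_zero).mp ⟨p, hv⟩
  rw [mul_comm s k]
  exact mul_dvd_mul_left k this

/-- If the determinant divides all the products of two entries, then its absolute value is an
integer which divides all the products of an entry with a conjugate of an entry. -/
theorem exists_int_norm_det {m : ℕ} (hm : Squarefree m) {L : Matrix (Fin 2) (Fin 2) (ringInt m)}
    (hdet : L.det ≠ 0) (hL : ∀ i j k l, L.det ∣ L i j * L k l) :
    ∃ g : ℕ, 0 < g ∧ (L.det : ℂ) * star (L.det : ℂ) = (g : ℂ) ^ 2 ∧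
      ∀ i j k l, (L i j : ℂ) * star (L k l : ℂ) / (g : ℂ) ∈ ringInt m := by
  have hdetC : (L.det : ℂ) ≠ 0 := fun h => hdet (Subtype.ext h)
  obtain ⟨D, hD⟩ := exists_int_norm L.det.2
  have hDpos : 0 < D := by
    have h1 : (0 : ℝ) < Complex.normSq (L.det : ℂ) := Complex.normSq_pos.mpr hdetC
    have h2 : ((Complex.normSq (L.det : ℂ) : ℝ) : ℂ) = ((D : ℝ) : ℂ) := by
      rw [← Complex.mul_conj, ← Complex.star_def, hD]
      simp
    rw [Complex.ofReal_inj.mp h2] at h1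
    exact_mod_cast h1
  -- Write the norm of the determinant as $D=k^2s$ with $s$ squarefree. The candidate for $|\det L|$
  -- is $g=sk$, and $s=1$ is proved only at the end.
  obtain ⟨s, k, hsk, hs⟩ := Nat.sq_mul_squarefree D.toNat
  have hskD : (k : ℤ) ^ 2 * s = D := by
    rw [← Int.toNat_of_nonneg hDpos.le, ← hsk]
    push_cast
    ring
  have hk0 : k ≠ 0 := by
    rintro rfl
    simp at hskD
    omega
  have hs0 : s ≠ 0 := hs.ne_zero
  have hg0 : (s : ℤ) * k ≠ 0 := by exact_mod_cast mul_ne_zero hs0 hk0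
  have hnorm : ∀ z : ringInt m, L.det ∣ z * z → ∀ n : ℤ, (z : ℂ) * star (z : ℂ) = n →
      (s : ℤ) * k ∣ n := by
    rintro z ⟨p, hp⟩ n hn
    obtain ⟨q, hq⟩ := exists_int_norm p.2
    have hpC : (z : ℂ) * z = L.det * p := by
      exact_mod_cast congrArg (fun x : ringInt m => (x : ℂ)) hp
    have hpC' : star (z : ℂ) * star (z : ℂ) = star (L.det : ℂ) * star (p : ℂ) := by
      rw [← star_mul', ← star_mul', hpC]
    refine sq_dvd_norm (p := q) (Int.squarefree_natCast.mpr hs) (by exact_mod_cast hk0) ?_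
    rw [hskD]
    have : (n : ℂ) ^ 2 = D * q := by
      rw [← hn, ← hD, ← hq]
      linear_combination star (z : ℂ) * star (z : ℂ) * hpC + (L.det : ℂ) * p * hpC'
    exact_mod_cast this
  -- Polarization: the trace of $z\overline{w}$ is $N(z+w)-N(z)-N(w)$, divisible by $g$, and its
  -- norm is $N(z)N(w)$, divisible by $g^2$.
  have hprod : ∀ i j k' l, (L i j : ℂ) * star (L k' l : ℂ) / ((s * k : ℤ) : ℂ) ∈ ringInt m := by
    intro i j k' l
    obtain ⟨n₁, hn₁⟩ := exists_int_norm (L i j).2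
    obtain ⟨n₂, hn₂⟩ := exists_int_norm (L k' l).2
    obtain ⟨n₃, hn₃⟩ := exists_int_norm (L i j + L k' l).2
    obtain ⟨c₁, hc₁⟩ := hnorm _ (hL i j i j) n₁ hn₁
    obtain ⟨c₂, hc₂⟩ := hnorm _ (hL k' l k' l) n₂ hn₂
    obtain ⟨c₃, hc₃⟩ := hnorm (L i j + L k' l) (by
      have e : (L i j + L k' l) * (L i j + L k' l)
          = L i j * L i j + L i j * L k' l + (L k' l * L i j + L k' l * L k' l) := by ring
      rw [e]
      exact dvd_add (dvd_add (hL _ _ _ _) (hL _ _ _ _)) (dvd_add (hL _ _ _ _) (hL _ _ _ _)))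
      n₃ hn₃
    have e₁ : (n₁ : ℂ) = ((s * k : ℤ) : ℂ) * c₁ := by exact_mod_cast hc₁
    have e₂ : (n₂ : ℂ) = ((s * k : ℤ) : ℂ) * c₂ := by exact_mod_cast hc₂
    have e₃ : (n₃ : ℂ) = ((s * k : ℤ) : ℂ) * c₃ := by exact_mod_cast hc₃
    have hadd : ((L i j + L k' l : ringInt m) : ℂ) = L i j + L k' l := rfl
    rw [hadd, star_add] at hn₃
    refine div_mem_ringInt hm (mul_mem (L i j).2 (star_mem_ringInt (L k' l).2)) hg0
      (k := c₃ - c₁ - c₂) (l := c₁ * c₂) ?_ ?_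
    · rw [star_mul', star_star]
      push_cast at e₁ e₂ e₃ ⊢
      linear_combination hn₃ - hn₁ - hn₂ + e₃ - e₁ - e₂
    · rw [star_mul', star_star]
      push_cast at e₁ e₂ e₃ ⊢
      linear_combination (L k' l : ℂ) * star (L k' l : ℂ) * hn₁ + n₁ * hn₂ + n₂ * e₁
        + (s * k * c₁ : ℂ) * e₂
  have hgC : ((s * k : ℤ) : ℂ) ≠ 0 := by exact_mod_cast hg0
  have hdetE : (L.det : ℂ) = (L 0 0 : ℂ) * L 1 1 - L 0 1 * L 1 0 := by
    rw [det_fin_two]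
    rfl
  -- Expanding $\det L\,\overline{\det L}$ writes $D/g^2$ as a polynomial in the integral quotients
  -- just obtained. Then $s^2k^2$ divides $k^2s$, which forces $s=1$.
  have htau : (D : ℂ) / ((s * k : ℤ) : ℂ) ^ 2 ∈ ringInt m := by
    have e : (D : ℂ) / ((s * k : ℤ) : ℂ) ^ 2
        = ((L 0 0 : ℂ) * star (L 0 0 : ℂ) / ((s * k : ℤ) : ℂ))
            * ((L 1 1 : ℂ) * star (L 1 1 : ℂ) / ((s * k : ℤ) : ℂ))
          - ((L 0 0 : ℂ) * star (L 0 1 : ℂ) / ((s * k : ℤ) : ℂ))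
            * ((L 1 1 : ℂ) * star (L 1 0 : ℂ) / ((s * k : ℤ) : ℂ))
          - ((L 0 1 : ℂ) * star (L 0 0 : ℂ) / ((s * k : ℤ) : ℂ))
            * ((L 1 0 : ℂ) * star (L 1 1 : ℂ) / ((s * k : ℤ) : ℂ))
          + ((L 0 1 : ℂ) * star (L 0 1 : ℂ) / ((s * k : ℤ) : ℂ))
            * ((L 1 0 : ℂ) * star (L 1 0 : ℂ) / ((s * k : ℤ) : ℂ)) := by
      rw [← hD, hdetE, star_sub, star_mul', star_mul']
      field_simp
      ring
    rw [e]
    exact add_mem (sub_mem (sub_mem (mul_mem (hprod _ _ _ _) (hprod _ _ _ _))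
      (mul_mem (hprod _ _ _ _) (hprod _ _ _ _))) (mul_mem (hprod _ _ _ _) (hprod _ _ _ _)))
      (mul_mem (hprod _ _ _ _) (hprod _ _ _ _))
  obtain ⟨τ, hτ⟩ := exists_int_of_mem_ringInt htau (by
    have : (D : ℂ) / ((s * k : ℤ) : ℂ) ^ 2 = (((D : ℝ) / ((s * k : ℤ) : ℝ) ^ 2 : ℝ) : ℂ) := by
      push_cast
      rfl
    rw [this, Complex.ofReal_im])
  have hs1 : s = 1 := by
    rw [div_eq_iff (pow_ne_zero 2 hgC)] at hτ
    have h1 : D = τ * (s * k) ^ 2 := by exact_mod_cast hτ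
    rw [← hskD] at h1
    have h2 : (1 : ℤ) = s * τ := by
      have h0 : (k : ℤ) ^ 2 * s ≠ 0 := by rw [hskD]; omega
      apply mul_left_cancel₀ h0
      linear_combination h1
    have h3 : (s : ℤ) ∣ 1 := ⟨τ, h2⟩
    exact Nat.dvd_one.mp (by exact_mod_cast h3)
  subst hs1
  refine ⟨k, Nat.pos_of_ne_zero hk0, ?_, ?_⟩
  · rw [hD, ← hskD]
    push_cast
    ring
  · simpa using hprod

/-- From $\det A=1$ one gets $u^2=\det L$, hence $u\overline{u}=|\det L|=g$, the integer of
`exists_int_norm_det`; the products in question are $L_{ij}\overline{L_{kl}}/g$. -/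
theorem isAdmissible_of_mem_extensionMatrices {m : ℕ} (hm : Squarefree m)
    {A : Matrix (Fin 2) (Fin 2) ℂ} (hA : A ∈ extensionMatrices m) : IsAdmissible m A := by
  obtain ⟨hdet, u, L, rfl, hI⟩ := hA
  refine ⟨hdet, ?_⟩
  rw [entryIdeal_sq_eq_iff] at hI
  have hmap : (L.map (fun x => (x : ℂ))).det = (L.det : ℂ) := by
    rw [det_fin_two, det_fin_two]
    rfl
  rw [det_smul, hmap, Fintype.card_fin] at hdet
  have hL0 : L.det ≠ 0 := fun h => by
    rw [h] at hdet
    simp at hdet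
  have hu0 : u ≠ 0 := fun h => by
    rw [h] at hdet
    simp at hdet
  obtain ⟨g, hg, hgd, hp⟩ := exists_int_norm_det hm hL0 hI
  have hu2 : (L.det : ℂ) = u ^ 2 := by
    field_simp at hdet
    exact hdet
  have hug : u * star u = g := by
    have h1 : (u * star u) ^ 2 = (g : ℂ) ^ 2 := by
      rw [← hgd, hu2, star_pow]
      ring
    have h2 : u * star u = ((Complex.normSq u : ℝ) : ℂ) := Complex.mul_conj u
    rw [h2] at h1 ⊢
    have h3 : Complex.normSq u ^ 2 = (g : ℝ) ^ 2 := by exact_mod_cast h1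
    have h4 := (pow_left_inj₀ (Complex.normSq_nonneg u) (Nat.cast_nonneg g) two_ne_zero).mp h3
    rw [h4]
    simp
  intro i j k l
  have e : ((1 / u) • L.map (fun x => (x : ℂ))) i j
      * star (((1 / u) • L.map (fun x => (x : ℂ))) k l)
      = (L i j : ℂ) * star (L k l : ℂ) / (g : ℂ) := by
    rw [← hug]
    simp only [Matrix.smul_apply, Matrix.map_apply, smul_eq_mul, star_mul', star_div₀, star_one]
    have : star u ≠ 0 := by simpa using hu0
    field_simp
  rw [e]
  exact hp i j k l

theorem mem_extensionMatrices_of_dvd {m : ℕ} {L : Matrix (Fin 2) (Fin 2) (ringInt m)} {u : ℂ}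
    (hu : u ^ 2 = (L.det : ℂ)) (hu0 : u ≠ 0) (hL : ∀ i j k l, L.det ∣ L i j * L k l) :
    (1 / u) • L.map (fun x => (x : ℂ)) ∈ extensionMatrices m := by
  refine ⟨?_, u, L, rfl, entryIdeal_sq_eq_iff.mpr hL⟩
  have hmap : (L.map (fun x => (x : ℂ))).det = (L.det : ℂ) := by
    rw [det_fin_two, det_fin_two]
    rfl
  rw [det_smul, hmap, Fintype.card_fin, ← hu]
  field_simp

/-! ### Matrices with upper left entry one -/

/-- The Hermitian matrix with first row `(1, t)` and lower right entry `l`. -/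
def normalMatrix (t l : ℂ) : Matrix (Fin 2) (Fin 2) ℂ := !![1, t; star t, l]

theorem normalMatrix_mem_fourierLattice_iff {m : ℕ} {t l : ℂ} :
    normalMatrix t l ∈ fourierLattice m ↔ t ∈ dualInt m ∧ ∃ k : ℤ, l = k := by
  constructor
  · intro h
    exact ⟨h.2.2 0 1 (by decide), h.2.1 1⟩
  · rintro ⟨⟨w, hw, rfl⟩, k, rfl⟩
    refine ⟨?_, fun i => ?_, fun i j hij => ?_⟩
    · ext i j
      fin_cases i <;> fin_cases j <;> simp [normalMatrix]
    · fin_cases i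
      · exact ⟨1, by simp [normalMatrix]⟩
      · exact ⟨k, rfl⟩
    · fin_cases i <;> fin_cases j
      · exact absurd rfl hij
      · exact ⟨w, hw, rfl⟩
      · refine ⟨-star w, neg_mem (star_mem_ringInt hw), ?_⟩
        change star ((sqrtDisc m)⁻¹ * w) = _
        rw [star_mul', star_inv₀, star_sqrtDisc, inv_neg]
        ring
      · exact absurd rfl hij

theorem det_normalMatrix (t l : ℂ) : (normalMatrix t l).det = l - t * star t := by
  rw [normalMatrix, det_fin_two_of, one_mul]

theorem dualInt_add_star_mem {m : ℕ} (hm : 0 < m) {t : ℂ} (ht : t ∈ dualInt m) :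
    t + star t ∈ ringInt m := by
  obtain ⟨w, ⟨a, b, rfl⟩, rfl⟩ := ht
  have e : (sqrtDisc m)⁻¹ * (a + b * omega m) + star ((sqrtDisc m)⁻¹ * (a + b * omega m)) = b := by
    have h := sqrtDisc_ne_zero hm
    rw [star_mul', star_inv₀, star_sqrtDisc, star_add, star_mul']
    simp only [star_intCast, inv_neg]
    field_simp
    rw [sqrtDisc_eq]
    ring
  rw [e]
  exact intCast_mem_ringInt m b

/-- The entry $1$ admits no integral division, so in Sugano's relation only the term `η = 1`
survives. -/
theorem content_normalMatrix {m : ℕ} {t l : ℂ} (h : normalMatrix t l ∈ fourierLattice m) :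
    content m (normalMatrix t l) = 1 := by
  have : {q : ℕ | 0 < q ∧ (1 / (q : ℂ)) • normalMatrix t l ∈ fourierLattice m} = {1} := by
    ext q
    constructor
    · rintro ⟨hq, -, hd, -⟩
      obtain ⟨k, hk⟩ := hd 0
      have hq0 : (q : ℂ) ≠ 0 := by exact_mod_cast hq.ne'
      have hk1 : (1 : ℂ) = q * k := by
        rw [← hk]
        simp [normalMatrix, hq0]
      have h1 : (1 : ℤ) = q * k := by exact_mod_cast hk1
      have h2 : (q : ℤ) ∣ 1 := ⟨k, h1⟩
      exact Nat.dvd_one.mp (by exact_mod_cast h2)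
    · rintro rfl
      refine ⟨one_pos, ?_⟩
      simpa using h
  rw [content, this, csSup_singleton]

/-- A substitution `Z ↦ A Z A*` acts on the coefficients at the matrices with upper left entry one
by a multiplication of the off-diagonal entry. -/
theorem fourierCoefficient_normalMatrix_eq {m : ℕ} (hm : 0 < m) {r : ℤ}
    {f : Matrix (Fin 2) (Fin 2) ℂ → ℂ} (hf : f ∈ suganoSpace m r)
    {A : Matrix (Fin 2) (Fin 2) ℂ} (hA : IsAdmissible m A)
    (hinv : ∀ Z ∈ halfSpace, f (A * Z * Aᴴ) = f Z) {t t' l l' : ℂ}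
    (hT : normalMatrix t l ∈ fourierLattice m) (hpos : (normalMatrix t l).PosSemidef)
    (hdet : (normalMatrix t l).det = (normalMatrix t' l').det)
    (h : t' - (star (A 0 0) * A 1 1 - star (A 1 0) * A 0 1) * t ∈ ringInt m) :
    fourierCoefficient m f (normalMatrix t l) = fourierCoefficient m f (normalMatrix t' l') := by
  obtain ⟨ht, k, hk⟩ := normalMatrix_mem_fourierLattice_iff.mp hT
  have hne : normalMatrix t l ≠ 0 := fun h0 => by
    have := congrFun (congrFun h0 0) 0
    simp [normalMatrix] at this
  set T₂ := Aᴴ * normalMatrix t l * A with hT₂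
  have hmem := hA.conj_mem_fourierLattice hm hT
  rw [← hT₂] at hmem
  have h1 := (hA.invariant_iff hm hf.1).mp hinv _ hT
  have h2 := hf.2 T₂ hmem (hA.posSemidef_conj_iff.mpr hpos) (hA.conj_ne_zero hne)
  rw [hA.content_conj hm, content_normalMatrix hT, Nat.divisors_one, Finset.sum_singleton] at h2
  have h10 : T₂ 1 0 = star (T₂ 0 1) := (congrFun (congrFun hmem.1 1) 0).symm
  have hform : !![1, T₂ 0 1 / ((1 : ℕ) : ℂ); T₂ 1 0 / ((1 : ℕ) : ℂ),
      T₂ 1 1 * T₂ 0 0 / ((1 : ℕ) : ℂ) ^ 2] = normalMatrix (T₂ 0 1) (T₂ 1 1 * T₂ 0 0) := by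
    simp [normalMatrix, h10]
  rw [hform] at h2
  simp only [Nat.cast_one, _root_.one_zpow, one_mul] at h2
  rw [← h1, h2]
  have h01 : T₂ 0 1 = star (A 0 0) * A 0 1 + star (A 0 0) * A 1 1 * t
      + star (A 1 0) * A 0 1 * star t + star (A 1 0) * A 1 1 * l := by
    simp [hT₂, normalMatrix, mul_apply, Fin.sum_univ_two]
    ring
  -- Replacing $\overline{t}$ by $(t+\overline{t})-t$ in the entry `T₂ 0 1` isolates the multiplier
  -- times $t$; all other terms are integral.
  have hμ : t' - T₂ 0 1 ∈ ringInt m := by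
    have e : t' - T₂ 0 1 = (t' - (star (A 0 0) * A 1 1 - star (A 1 0) * A 0 1) * t)
        - (A 0 1 * star (A 0 0) + A 0 1 * star (A 1 0) * (t + star t)
          + A 1 1 * star (A 1 0) * l) := by
      rw [h01]
      ring
    rw [e, hk]
    exact sub_mem h (add_mem (add_mem (hA.2 _ _ _ _)
      (mul_mem (hA.2 _ _ _ _) (dualInt_add_star_mem hm ht)))
      (mul_mem (hA.2 _ _ _ _) (intCast_mem_ringInt m k)))
  have hmem₂ : normalMatrix (T₂ 0 1) (T₂ 1 1 * T₂ 0 0) ∈ fourierLattice m := by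
    obtain ⟨a, ha⟩ := hmem.2.1 0
    obtain ⟨b, hb⟩ := hmem.2.1 1
    exact normalMatrix_mem_fourierLattice_iff.mpr
      ⟨hmem.2.2 0 1 (by decide), b * a, by rw [ha, hb]; push_cast; rfl⟩
  -- A unipotent substitution moves the off-diagonal entry to `t'`; the lower right entry is then
  -- forced by the determinant.
  have h3 := fourierCoefficient_unimodular hm hf.1 (U := !![1, t' - T₂ 0 1; 0, 1]) (by simp)
    (fun i j => by
      fin_cases i <;> fin_cases j
      · exact one_mem _
      · exact hμ
      · exact zero_mem _
      · exact one_mem _) hmem₂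
  rw [← h3]
  have hd₂ : T₂.det = l' - t' * star t' := by
    rw [hT₂, hA.det_conj, hdet, det_normalMatrix]
  rw [det_fin_two, h10] at hd₂
  congr 1
  ext i j
  fin_cases i <;> fin_cases j
  · simp [normalMatrix, mul_apply, Fin.sum_univ_two]
  · simp [normalMatrix, mul_apply, Fin.sum_univ_two]
  · simp [normalMatrix, mul_apply, Fin.sum_univ_two]
  · simp [normalMatrix, mul_apply, Fin.sum_univ_two] at hd₂ ⊢
    linear_combination hd₂

/-! ### Multipliers of the extension -/

/-- The multiplier by which `A` acts on the discriminant group. -/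
def multiplier (A : Matrix (Fin 2) (Fin 2) ℂ) : ℂ := star (A 0 0) * A 1 1 - star (A 1 0) * A 0 1

/-- The matrix $L$ with rows $(qa,\sqrt{-m}\,b)$ and $(\sqrt{-m},q)$ has determinant $q(qa+q'b)=q$,
and $q$ divides $(\sqrt{-m})^2=-qq'$. The multiplier $qa-q'b$ is $-1$ modulo $q$ and $+1$ modulo
$q'$. -/
theorem exists_multiplier_of_coprime {m : ℕ} {q q' a b : ℤ} (hq : 0 < q)
    (hqq : q * q' = m) (hab : q * a + q' * b = 1) :
    ∃ A ∈ extensionMatrices m, multiplier A = ((q * a - q' * b : ℤ) : ℂ) := by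
  let S : ringInt m := ⟨sqrtNeg m, sqrtNeg_mem_ringInt m⟩
  have hS : S * S = -((q : ringInt m) * q') := by
    apply Subtype.ext
    have h1 : ((q : ℂ) * q') = m := by exact_mod_cast hqq
    change sqrtNeg m * sqrtNeg m = _
    rw [sqrtNeg_mul_self, ← h1]
    simp
  have habR : (q : ringInt m) * a + q' * b = 1 := by exact_mod_cast congrArg (Int.cast) hab
  let L : Matrix (Fin 2) (Fin 2) (ringInt m) := !![(q : ringInt m) * a, S * b; S, (q : ringInt m)]
  have hdet : L.det = (q : ringInt m) := by
    simp only [L, det_fin_two_of]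
    linear_combination (q : ringInt m) * habR - (b : ringInt m) * hS
  have hentry : ∀ i j, (q : ringInt m) ∣ L i j ∨ ∃ c, L i j = S * c := by
    intro i j
    fin_cases i <;> fin_cases j
    · exact Or.inl ⟨a, rfl⟩
    · exact Or.inr ⟨b, rfl⟩
    · exact Or.inr ⟨1, (mul_one S).symm⟩
    · exact Or.inl ⟨1, (mul_one (q : ringInt m)).symm⟩
  have hL : ∀ i j k l, L.det ∣ L i j * L k l := by
    intro i j k l
    rw [hdet]
    rcases hentry i j with h | ⟨c, hc⟩
    · exact dvd_mul_of_dvd_left h _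
    rcases hentry k l with h | ⟨c', hc'⟩
    · exact dvd_mul_of_dvd_right h _
    rw [hc, hc']
    exact ⟨-(q' * c * c'), by linear_combination c * c' * hS⟩
  have hqR : (0 : ℝ) < q := by exact_mod_cast hq
  have hu2 : ((Real.sqrt q : ℝ) : ℂ) ^ 2 = q := by
    rw [← Complex.ofReal_pow, Real.sq_sqrt hqR.le]
    simp
  have hu0 : ((Real.sqrt q : ℝ) : ℂ) ≠ 0 :=
    Complex.ofReal_ne_zero.mpr (Real.sqrt_ne_zero'.mpr hqR)
  refine ⟨_, mem_extensionMatrices_of_dvd (L := L) (u := ((Real.sqrt q : ℝ) : ℂ))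
    (by rw [hu2, hdet]; simp) hu0 hL, ?_⟩
  have hqC : (q : ℂ) ≠ 0 := by exact_mod_cast hq.ne'
  have e00 : ((L 0 0 : ringInt m) : ℂ) = q * a := by simp [L]
  have e01 : ((L 0 1 : ringInt m) : ℂ) = sqrtNeg m * b := by simp [L, S]
  have e10 : ((L 1 0 : ringInt m) : ℂ) = sqrtNeg m := rfl
  have e11 : ((L 1 1 : ringInt m) : ℂ) = q := by simp [L]
  have hsC := sqrtNeg_mul_self m
  have hmC : (q : ℂ) * q' = m := by exact_mod_cast hqq
  have hstar : star ((Real.sqrt q : ℝ) : ℂ) = ((Real.sqrt q : ℝ) : ℂ) := Complex.conj_ofReal _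
  simp only [multiplier, Matrix.smul_apply, Matrix.map_apply, smul_eq_mul, e00, e01, e10, e11,
    star_mul', star_div₀, star_one, hstar, star_intCast, star_sqrtNeg]
  push_cast
  have e : (1 / ((Real.sqrt q : ℝ) : ℂ)) * (1 / ((Real.sqrt q : ℝ) : ℂ)) = 1 / (q : ℂ) := by
    rw [← hu2]
    field_simp
  have e' : (1 / (q : ℂ)) * q = 1 := one_div_mul_cancel hqC
  linear_combination (q * a * q + sqrtNeg m * (sqrtNeg m * b)) * e
    + (1 / (q : ℂ)) * b * hsC + (q * a - q' * b) * e' + (1 / (q : ℂ)) * b * hmC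

/-- The entries are $0$ or $1+\sqrt{-m}$ modulo $2$, and $(1+\sqrt{-m})^2$ is divisible by $2$: this
is the ramified prime above $2$. Its multiplier exchanges the parities of the two coordinates, which
no odd integer multiplier can do. -/
theorem exists_multiplier_two {m : ℕ} (hm : m % 4 = 1) :
    ∃ A ∈ extensionMatrices m, multiplier A = 1 - m - sqrtNeg m := by
  obtain ⟨j, hj⟩ : ∃ j : ℕ, m = 4 * j + 1 := ⟨m / 4, by omega⟩
  let S : ringInt m := ⟨sqrtNeg m, sqrtNeg_mem_ringInt m⟩
  have hS : S * S = -(4 * (j : ringInt m) + 1) := by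
    apply Subtype.ext
    have h1 : (4 * (j : ℂ) + 1) = m := by exact_mod_cast hj.symm
    change sqrtNeg m * sqrtNeg m = -(((4 : ringInt m) : ℂ) * ((j : ringInt m) : ℂ) + 1)
    rw [sqrtNeg_mul_self, ← h1]
    rfl
  let L : Matrix (Fin 2) (Fin 2) (ringInt m) := !![1 + S, 2; 2 * (j : ringInt m), 1 - S]
  have hdet : L.det = 2 := by
    simp only [L, det_fin_two_of]
    linear_combination -hS
  have hentry : ∀ i j, (∃ c, L i j = 2 * c) ∨ ∃ c, L i j = 1 + S + 2 * c := by
    intro i k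
    fin_cases i <;> fin_cases k
    · exact Or.inr ⟨0, by simp [L]⟩
    · exact Or.inl ⟨1, by simp [L]⟩
    · exact Or.inl ⟨j, by simp [L]⟩
    · exact Or.inr ⟨-S, by simp [L]; ring⟩
  have hL : ∀ i j k l, L.det ∣ L i j * L k l := by
    intro i k i' k'
    rw [hdet]
    rcases hentry i k with ⟨c, hc⟩ | ⟨c, hc⟩
    · exact dvd_mul_of_dvd_left ⟨c, hc⟩ _
    rcases hentry i' k' with ⟨c', hc'⟩ | ⟨c', hc'⟩
    · exact dvd_mul_of_dvd_right ⟨c', hc'⟩ _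
    rw [hc, hc']
    exact ⟨S - 2 * j + (1 + S) * c + (1 + S) * c' + 2 * c * c', by linear_combination hS⟩
  have hu2 : ((Real.sqrt 2 : ℝ) : ℂ) ^ 2 = 2 := by
    rw [← Complex.ofReal_pow, Real.sq_sqrt (by norm_num)]
    simp
  have hu0 : ((Real.sqrt 2 : ℝ) : ℂ) ≠ 0 :=
    Complex.ofReal_ne_zero.mpr (Real.sqrt_ne_zero'.mpr (by norm_num))
  refine ⟨_, mem_extensionMatrices_of_dvd (L := L) (u := ((Real.sqrt 2 : ℝ) : ℂ))
    (by rw [hu2, hdet]; rfl) hu0 hL, ?_⟩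
  have e00 : ((L 0 0 : ringInt m) : ℂ) = 1 + sqrtNeg m := rfl
  have e01 : ((L 0 1 : ringInt m) : ℂ) = 2 := rfl
  have e10 : ((L 1 0 : ringInt m) : ℂ) = 2 * (j : ℂ) := rfl
  have e11 : ((L 1 1 : ringInt m) : ℂ) = 1 - sqrtNeg m := rfl
  have hsC := sqrtNeg_mul_self m
  have hmC : (m : ℂ) = 4 * j + 1 := by exact_mod_cast hj
  have hstar : star ((Real.sqrt 2 : ℝ) : ℂ) = ((Real.sqrt 2 : ℝ) : ℂ) := Complex.conj_ofReal _
  have hstar2 : star (2 : ℂ) = 2 := star_ofNat 2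
  simp only [multiplier, Matrix.smul_apply, Matrix.map_apply, smul_eq_mul, e00, e01, e10, e11,
    star_mul', star_div₀, star_one, hstar, star_add, star_natCast, star_sqrtNeg, hstar2]
  have e : (1 / ((Real.sqrt 2 : ℝ) : ℂ)) * (1 / ((Real.sqrt 2 : ℝ) : ℂ)) = 1 / 2 := by
    rw [← hu2]
    field_simp
  linear_combination ((1 - sqrtNeg m) * (1 - sqrtNeg m) - 4 * j) * e + (1 / 2) * hsC
    + (1 / 2) * hmC

/-- Take $q=\gcd(X,m)$; the complementary factor is coprime to it because $m$ is squarefree. -/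
theorem exists_coprime_splitting {m : ℕ} (hm : Squarefree m) {X Y : ℤ} (h : (m : ℤ) ∣ X * Y) :
    ∃ q q' a b : ℤ, 0 < q ∧ q * q' = m ∧ q * a + q' * b = 1 ∧ q ∣ X ∧ q' ∣ Y := by
  have hm0 : (m : ℤ) ≠ 0 := by exact_mod_cast hm.ne_zero
  have hg : 0 < Int.gcd X m := Int.gcd_pos_of_ne_zero_right _ hm0
  obtain ⟨g, X', m', hg0, hcop, hX, hm'⟩ := Int.exists_gcd_one' hg
  have hsq : Squarefree (m' * g : ℤ) := by
    rw [← hm']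
    exact squarefree_intCast hm
  have hrel : IsCoprime (g : ℤ) m' := ((squarefree_mul_iff.mp hsq).1.isCoprime).symm
  obtain ⟨a, b, hab⟩ := hrel
  refine ⟨g, m', a, b, by exact_mod_cast hg0, by rw [hm']; ring, by linear_combination hab,
    ⟨X', by rw [hX]; ring⟩, ?_⟩
  have hgz : (g : ℤ) ≠ 0 := by exact_mod_cast hg0.ne'
  rw [hm', hX] at h
  have h1 : m' ∣ X' * Y := by
    refine Int.dvd_of_mul_dvd_mul_right hgz ?_
    rwa [show X' * Y * g = X' * g * Y by ring]
  exact (Int.isCoprime_iff_gcd_eq_one.mpr hcop).symm.dvd_of_dvd_mul_left h1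

theorem sqrtNeg_ne_zero {m : ℕ} (hm : 0 < m) : sqrtNeg m ≠ 0 := by
  intro h
  have := sqrtNeg_mul_self m
  rw [h] at this
  simp at this
  omega

theorem sqrtDisc_eq_of_mod {m : ℕ} (h : m % 4 = 3) : sqrtDisc m = sqrtNeg m := by
  rw [sqrtDisc_eq, omega, if_pos h, star_div₀, star_add, star_sqrtNeg]
  simp
  ring

theorem sqrtDisc_eq_of_mod_ne {m : ℕ} (h : m % 4 ≠ 3) : sqrtDisc m = 2 * sqrtNeg m := by
  rw [sqrtDisc_eq, omega, if_neg h, star_sqrtNeg]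
  ring

/-- Modulo $\sqrt{-m}$ the generator $\omega$ is the integer $2j+2$, so $w$ and $w'$ become integers
$x,x'$ with $x^2\equiv x'^2$ mod $m$. Splitting $m$ along $(x+x')(x'-x)$ gives the multiplier with
$x'\equiv\lambda x$. -/
theorem exists_multiplier_of_mod {m : ℕ} (hm : Squarefree m) (h3 : m % 4 = 3) {w w' : ℂ}
    (hw : w ∈ ringInt m) (hw' : w' ∈ ringInt m) {c : ℤ}
    (hN : w * star w - w' * star w' = m * c) : ∃ A ∈ extensionMatrices m,
      (sqrtDisc m)⁻¹ * w' - multiplier A * ((sqrtDisc m)⁻¹ * w) ∈ ringInt m := by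
  have hm0 : 0 < m := Nat.pos_of_ne_zero hm.ne_zero
  obtain ⟨j, hj⟩ : ∃ j : ℕ, m = 4 * j + 3 := ⟨m / 4, by omega⟩
  have hjC : (m : ℂ) = 4 * j + 3 := by exact_mod_cast hj
  have hs := sqrtNeg_mul_self m
  have hs0 := sqrtNeg_ne_zero hm0
  have hω : sqrtNeg m = 2 * omega m - 1 := by
    rw [omega, if_pos h3]
    ring
  have hωs : star (omega m) = 1 - omega m := by
    rw [omega, if_pos h3, star_div₀, star_add, star_sqrtNeg]
    simp
    ring
  have hω2 : omega m * omega m = omega m - (j + 1) := by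
    rw [hω] at hs
    linear_combination hs / 4 - hjC / 4
  obtain ⟨a, b, rfl⟩ := hw
  obtain ⟨a', b', rfl⟩ := hw'
  have hnorm : ∀ a b : ℤ, ((a : ℂ) + b * omega m) * star ((a : ℂ) + b * omega m)
      = (a + b * (2 * j + 2)) ^ 2 - m * (a * b + b ^ 2 * (j + 1)) := by
    intro a b
    rw [star_add, star_mul', hωs, star_intCast, star_intCast, hjC]
    linear_combination -(b : ℂ) ^ 2 * hω2
  rw [hnorm, hnorm] at hN
  set x := a + b * (2 * j + 2) with hx
  set x' := a' + b' * (2 * j + 2) with hx'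
  have hdvd : (m : ℤ) ∣ (x + x') * (x' - x) := by
    refine ⟨-(c + (a * b + b ^ 2 * (j + 1)) - (a' * b' + b' ^ 2 * (j + 1))), ?_⟩
    have : ((x : ℂ) + x') * (x' - x)
        = m * -(c + (a * b + b ^ 2 * (j + 1)) - (a' * b' + b' ^ 2 * (j + 1))) := by
      rw [hx, hx']
      push_cast
      linear_combination -hN
    exact_mod_cast this
  obtain ⟨q, q', u, v, hq, hqq, huv, ⟨y, hy⟩, ⟨y', hy'⟩⟩ := exists_coprime_splitting hm hdvd
  obtain ⟨A, hA, hmul⟩ := exists_multiplier_of_coprime hq hqq huv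
  refine ⟨A, hA, ?_⟩
  have hcop : IsCoprime q q' := ⟨u, v, by linear_combination huv⟩
  have hz : (m : ℤ) ∣ x' - (q * u - q' * v) * x := by
    rw [← hqq]
    refine hcop.mul_dvd ⟨y - 2 * u * x, ?_⟩ ⟨y' + 2 * v * x, ?_⟩
    · linear_combination hy + x * huv
    · linear_combination hy' - x * huv
  obtain ⟨z, hz⟩ := hz
  rw [hmul, sqrtDisc_eq_of_mod h3]
  have hzC : (x' : ℂ) - ((q * u - q' * v : ℤ) : ℂ) * x = m * z := by exact_mod_cast hz
  have e : (sqrtNeg m)⁻¹ * (a' + b' * omega m)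
      - ((q * u - q' * v : ℤ) : ℂ) * ((sqrtNeg m)⁻¹ * (a + b * omega m))
      = -sqrtNeg m * z + b' * omega m - ((q * u - q' * v : ℤ) : ℂ) * (b * omega m) := by
    have hsω : sqrtNeg m * omega m = omega m - (2 * j + 2) := by
      rw [hω]
      linear_combination 2 * hω2
    rw [hx, hx'] at hzC
    generalize ((q * u - q' * v : ℤ) : ℂ) = lam at *
    push_cast at hzC
    field_simp
    linear_combination hzC + (z : ℂ) * hs + (lam * b - b') * hsω
  rw [e]
  have hωm := omega_mem_ringInt m
  exact sub_mem (add_mem (mul_mem (neg_mem (sqrtNeg_mem_ringInt m)) (intCast_mem_ringInt m z))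
    (mul_mem (intCast_mem_ringInt m _) hωm))
    (mul_mem (intCast_mem_ringInt m _) (mul_mem (intCast_mem_ringInt m _) hωm))

/-- Here $\sqrt{d_{\mathbb{K}}}=2\sqrt{-m}$, so one needs $x'\equiv\lambda x$ mod $2m$ and
$y'\equiv\lambda y$ mod $2$. The latter is automatic, as $\lambda=2qu-1$ is odd; for the former, $m$
is split along $\frac{x+x'}2\cdot\frac{x-x'}2$. -/
theorem exists_multiplier_of_mod_ne {m : ℕ} (hm : Squarefree m) (h3 : m % 4 ≠ 3) {x y x' y' c : ℤ}
    (hy : 2 ∣ y - y') (hN : x ^ 2 + m * y ^ 2 - (x' ^ 2 + m * y' ^ 2) = 4 * m * c) :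
    ∃ A ∈ extensionMatrices m, (sqrtDisc m)⁻¹ * (x' + y' * sqrtNeg m)
      - multiplier A * ((sqrtDisc m)⁻¹ * (x + y * sqrtNeg m)) ∈ ringInt m := by
  have hm0 : 0 < m := Nat.pos_of_ne_zero hm.ne_zero
  have hs := sqrtNeg_mul_self m
  have hs0 := sqrtNeg_ne_zero hm0
  obtain ⟨e, he⟩ := hy
  obtain rfl : y = y' + 2 * e := by linarith
  have hxx : (x + x') * (x - x') = 4 * m * (c - e * (y' + e)) := by linear_combination hN
  have hpar : (2 : ℤ) ∣ x - x' := by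
    have h2 : (2 : ℤ) ∣ (x + x') * (x - x') := ⟨2 * m * (c - e * (y' + e)), by rw [hxx]; ring⟩
    rcases Int.prime_two.dvd_or_dvd h2 with h | h <;> omega
  obtain ⟨Y, hY⟩ := hpar
  obtain rfl : x = x' + 2 * Y := by linarith
  have hdvd : (m : ℤ) ∣ (x' + Y) * Y := ⟨c - e * (y' + e), by linarith [hxx]⟩
  obtain ⟨q, q', u, v, hq, hqq, huv, ⟨z, hz⟩, ⟨z', hz'⟩⟩ := exists_coprime_splitting hm hdvd
  obtain ⟨A, hA, hmul⟩ := exists_multiplier_of_coprime hq hqq huv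
  refine ⟨A, hA, ?_⟩
  have hcop : IsCoprime q q' := ⟨u, v, by linear_combination huv⟩
  have hd : (m : ℤ) ∣ x' + Y - q * u * (x' + 2 * Y) := by
    rw [← hqq]
    refine hcop.mul_dvd ⟨z - u * (x' + 2 * Y), ?_⟩ ⟨-z' + v * (x' + 2 * Y), ?_⟩
    · linear_combination hz
    · linear_combination -hz' - (x' + 2 * Y) * huv
  obtain ⟨k, hk⟩ := hd
  rw [hmul, sqrtDisc_eq_of_mod_ne h3]
  have hkC : (x' : ℂ) + Y - q * u * (x' + 2 * Y) = m * k := by exact_mod_cast hk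
  have huvC : (q : ℂ) * u + q' * v = 1 := by exact_mod_cast huv
  have e1 : (2 * sqrtNeg m)⁻¹ * (x' + y' * sqrtNeg m) - ((q * u - q' * v : ℤ) : ℂ) *
      ((2 * sqrtNeg m)⁻¹ * (((x' + 2 * Y : ℤ) : ℂ) + ((y' + 2 * e : ℤ) : ℂ) * sqrtNeg m))
      = -sqrtNeg m * k + ((y' + e - q * u * (y' + 2 * e) : ℤ) : ℂ) := by
    push_cast
    field_simp
    linear_combination 2 * hkC + 2 * (k : ℂ) * hs
      + ((x' : ℂ) + 2 * Y + (y' + 2 * e) * sqrtNeg m) * huvC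
  rw [e1]
  exact add_mem (mul_mem (neg_mem (sqrtNeg_mem_ringInt m)) (intCast_mem_ringInt m k))
    (intCast_mem_ringInt m _)

/-! ### Comparison of the two Maaß spaces -/

theorem neg_disc_eq {m : ℕ} : -(disc m : ℂ) = sqrtDisc m * star (sqrtDisc m) := by
  have hd : 0 ≤ -(disc m : ℝ) := by
    unfold disc
    split_ifs <;> simp
  have : (Real.sqrt (-(disc m : ℝ)) : ℂ) * (Real.sqrt (-(disc m : ℝ)) : ℂ) = -(disc m : ℂ) := by
    rw [← Complex.ofReal_mul, Real.mul_self_sqrt hd]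
    simp
  simp only [sqrtDisc, star_mul', Complex.star_def, Complex.conj_I, Complex.conj_ofReal]
  linear_combination -this + (Real.sqrt (-(disc m : ℝ)) : ℂ) ^ 2 * Complex.I_mul_I

/-- For forms on the extended group, the coefficients at matrices with upper left entry one depend
only on the determinant. -/
theorem fourierCoefficient_normalMatrix_eq_of_det {m : ℕ} (hm : Squarefree m) {r : ℤ}
    {f : Matrix (Fin 2) (Fin 2) ℂ → ℂ} (hf : f ∈ suganoSpace m r)
    (hext : f ∈ modularForms (extendedGroup m) r) {t t' l l' : ℂ}
    (hT : normalMatrix t l ∈ fourierLattice m) (hpos : (normalMatrix t l).PosSemidef)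
    (hT' : normalMatrix t' l' ∈ fourierLattice m)
    (hdet : (normalMatrix t l).det = (normalMatrix t' l').det) :
    fourierCoefficient m f (normalMatrix t l) = fourierCoefficient m f (normalMatrix t' l') := by
  have hm0 : 0 < m := Nat.pos_of_ne_zero hm.ne_zero
  have hinv := (mem_modularForms_extendedGroup_iff hf.1).mp hext
  have hstep : ∀ {A : Matrix (Fin 2) (Fin 2) ℂ} {t t' l l' : ℂ}, A ∈ extensionMatrices m →
      normalMatrix t l ∈ fourierLattice m → (normalMatrix t l).PosSemidef →
      (normalMatrix t l).det = (normalMatrix t' l').det → t' - multiplier A * t ∈ ringInt m →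
      fourierCoefficient m f (normalMatrix t l) = fourierCoefficient m f (normalMatrix t' l') :=
    fun hA hT hpos hdet h => fourierCoefficient_normalMatrix_eq hm0 hf
      (isAdmissible_of_mem_extensionMatrices hm hA) (hinv _ hA) hT hpos hdet h
  have hD0 := sqrtDisc_ne_zero hm0
  have hD0' : star (sqrtDisc m) ≠ 0 := by simpa using hD0
  obtain ⟨⟨w, hw, rfl⟩, k, rfl⟩ := normalMatrix_mem_fourierLattice_iff.mp hT
  obtain ⟨⟨w', hw', rfl⟩, k', rfl⟩ := normalMatrix_mem_fourierLattice_iff.mp hT'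
  have hnorm : ∀ w : ℂ, (sqrtDisc m)⁻¹ * w * star ((sqrtDisc m)⁻¹ * w)
      = w * star w / -(disc m : ℂ) := by
    intro w
    rw [neg_disc_eq, star_mul', star_inv₀]
    field_simp
  have hdisc0 : -(disc m : ℂ) ≠ 0 := by
    rw [neg_disc_eq]
    exact mul_ne_zero hD0 hD0'
  have hN : w * star w - w' * star w' = -(disc m : ℂ) * (k - k') := by
    have h := hdet
    rw [det_normalMatrix, det_normalMatrix, hnorm, hnorm] at h
    generalize -(disc m : ℂ) = d at *
    field_simp at h
    linear_combination -h
  by_cases h3 : m % 4 = 3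
  · have hd : -(disc m : ℂ) = m := by simp [disc, h3]
    rw [hd] at hN
    obtain ⟨A, hA, h⟩ := exists_multiplier_of_mod hm h3 hw hw' (c := k - k') (by push_cast; exact hN)
    exact hstep hA hT hpos hdet h
  · have hd : -(disc m : ℂ) = 4 * m := by simp [disc, h3]
    have hs := sqrtNeg_mul_self m
    obtain ⟨x, y, rfl⟩ := hw
    obtain ⟨x', y', rfl⟩ := hw'
    have hω : omega m = sqrtNeg m := by rw [omega, if_neg h3]
    have hxy : ∀ x y : ℤ, ((x : ℂ) + y * sqrtNeg m) * star ((x : ℂ) + y * sqrtNeg m)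
        = x ^ 2 + m * y ^ 2 := by
      intro x y
      rw [star_add, star_mul', star_sqrtNeg, star_intCast, star_intCast]
      linear_combination -(y : ℂ) ^ 2 * hs
    rw [hd, hω, hxy, hxy] at hN
    rw [hω] at hT hpos hdet hT' ⊢
    have hNZ : x ^ 2 + m * y ^ 2 - (x' ^ 2 + m * y' ^ 2) = 4 * m * (k - k') := by exact_mod_cast hN
    by_cases hy : (2 : ℤ) ∣ y - y'
    · obtain ⟨A, hA, h⟩ := exists_multiplier_of_mod_ne hm h3 hy hNZ
      exact hstep hA hT hpos hdet h
    have h4 := mod_four_ne_zero hm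
    have hmod : (x * x + m * (y * y) - (x' * x' + m * (y' * y'))) % 4 = 0 := by
      have : x * x + m * (y * y) - (x' * x' + m * (y' * y')) = 4 * (m * (k - k')) := by
        linear_combination hNZ
      omega
    have hsq : ∀ z : ℤ, (z % 2 = 0 ∧ z * z % 4 = 0) ∨ (z % 2 = 1 ∧ z * z % 4 = 1) := by
      intro z
      rcases Int.even_or_odd' z with ⟨c, rfl | rfl⟩
      · left
        have : 2 * c * (2 * c) = 4 * (c * c) := by ring
        omega
      · right
        have : (2 * c + 1) * (2 * c + 1) = 4 * (c * c + c) + 1 := by ring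
        omega
    have hmul : ∀ z : ℤ, (m : ℤ) * z % 4 = ((m : ℤ) % 4 * (z % 4)) % 4 :=
      fun z => Int.mul_emod _ _ _
    have hmy := hmul (y * y)
    have hmy' := hmul (y' * y')
    -- With $y\not\equiv y'$ mod $2$, the norms modulo $4$ exclude $m\equiv2$ and show that the
    -- parities of the coordinates are interchanged.
    have hcase : m % 4 = 1 ∧ (2 : ℤ) ∣ x - y' := by
      have hm12 : (m : ℤ) % 4 = 1 ∨ (m : ℤ) % 4 = 2 := by omega
      rcases hsq x with ⟨a1, a2⟩ | ⟨a1, a2⟩ <;> rcases hsq y with ⟨b1, b2⟩ | ⟨b1, b2⟩ <;>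
        rcases hsq x' with ⟨c1, c2⟩ | ⟨c1, c2⟩ <;> rcases hsq y' with ⟨d1, d2⟩ | ⟨d1, d2⟩ <;>
        rcases hm12 with h | h <;> rw [h, b2] at hmy <;> rw [h, d2] at hmy' <;> omega
    obtain ⟨hm1, hxy'⟩ := hcase
    obtain ⟨j, hj⟩ : ∃ j : ℕ, m = 4 * j + 1 := ⟨m / 4, by omega⟩
    have hjC : (m : ℂ) = 4 * j + 1 := by exact_mod_cast hj
    have hjZ : (m : ℤ) = 4 * j + 1 := by exact_mod_cast hj
    obtain ⟨A, hA, hmulA⟩ := exists_multiplier_two hm1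
    -- The product with the multiplier $1-m-\sqrt{-m}$, whose norm is $m^2-m+1$. As $(m-1)/4=j$, the
    -- choice of `k₁` keeps the determinant, and $y_1\equiv x\equiv y'$ mod $2$ permits the previous
    -- case.
    let x₁ : ℤ := (1 - m) * x + m * y
    let y₁ : ℤ := (1 - m) * y - x
    let k₁ : ℤ := k + j * (x ^ 2 + m * y ^ 2)
    have hw₁ : ((x₁ : ℂ) + y₁ * sqrtNeg m) = (1 - m - sqrtNeg m) * (x + y * sqrtNeg m) := by
      simp only [x₁, y₁]
      push_cast
      linear_combination (y : ℂ) * hs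
    have hdet₁ : (normalMatrix ((sqrtDisc m)⁻¹ * (x + y * sqrtNeg m)) k).det
        = (normalMatrix ((sqrtDisc m)⁻¹ * (x₁ + y₁ * sqrtNeg m)) k₁).det := by
      rw [det_normalMatrix, det_normalMatrix, hnorm, hnorm, hxy, hxy, hd]
      have hmC : (m : ℂ) ≠ 0 := by exact_mod_cast hm0.ne'
      simp only [x₁, y₁, k₁]
      push_cast
      field_simp
      rw [hjC]
      ring
    have hT₁ : normalMatrix ((sqrtDisc m)⁻¹ * (x₁ + y₁ * sqrtNeg m)) k₁ ∈ fourierLattice m :=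
      normalMatrix_mem_fourierLattice_iff.mpr ⟨⟨_, ⟨x₁, y₁, by rw [hω]⟩, rfl⟩, k₁, rfl⟩
    have hpos₁ : (normalMatrix ((sqrtDisc m)⁻¹ * (x₁ + y₁ * sqrtNeg m)) k₁).PosSemidef := by
      refine posSemidef_fin_two hT₁.1 (by simp [normalMatrix]) ?_
      rw [← hdet₁]
      exact (Complex.nonneg_iff.mp hpos.det_nonneg).1
    rw [hstep hA hT hpos hdet₁ (by
      rw [hmulA, hw₁]
      have : (sqrtDisc m)⁻¹ * ((1 - m - sqrtNeg m) * (x + y * sqrtNeg m))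
        - (1 - m - sqrtNeg m) * ((sqrtDisc m)⁻¹ * (x + y * sqrtNeg m)) = 0 := by ring
      rw [this]
      exact zero_mem _)]
    obtain ⟨B, hB, h⟩ := exists_multiplier_of_mod_ne hm h3 (x := x₁) (y := y₁) (x' := x') (y' := y')
      (c := k₁ - k') (by
        obtain ⟨e, he⟩ := hxy'
        refine ⟨-2 * j * y - x + e, ?_⟩
        simp only [y₁]
        linear_combination he - y * hjZ) (by
        simp only [x₁, y₁, k₁]
        linear_combination hNZ + (m : ℤ) * (x ^ 2 + m * y ^ 2) * hjZ)
    exact hstep hB hT₁ hpos₁ (hdet₁.symm.trans hdet) h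

/-- The matrix in Sugano's relation, for a divisor of the content. -/
theorem sugano_matrix {m : ℕ} {T : Matrix (Fin 2) (Fin 2) ℂ} (hT : T ∈ fourierLattice m)
    (hpos : T.PosSemidef) {η : ℕ} (hη : η ∈ (content m T).divisors) :
    ∃ t l : ℂ, !![1, T 0 1 / (η : ℂ); T 1 0 / η, T 1 1 * T 0 0 / (η : ℂ) ^ 2] = normalMatrix t l ∧
      normalMatrix t l ∈ fourierLattice m ∧ (normalMatrix t l).PosSemidef ∧
      natDet m (normalMatrix t l) 1 = natDet m T η := by
  obtain ⟨⟨c, hc⟩, hne⟩ := Nat.mem_divisors.mp hη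
  have hη0 : η ≠ 0 := by
    rintro rfl
    simp at hc
    exact hne hc
  have hηC : (η : ℂ) ≠ 0 := by exact_mod_cast hη0
  have hmem : (1 / (content m T : ℂ)) • T ∈ fourierLattice m := by
    -- An unbounded supremum in `ℕ` has the default value `0`, which has no divisors; so the set is
    -- bounded and the content is attained.
    have hS : {q : ℕ | 0 < q ∧ (1 / (q : ℂ)) • T ∈ fourierLattice m}.Nonempty ∧
        BddAbove {q : ℕ | 0 < q ∧ (1 / (q : ℂ)) • T ∈ fourierLattice m} := by
      constructor
      · exact ⟨1, one_pos, by simpa using hT⟩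
      · by_contra hb
        exact hne (Nat.sSup_of_not_bddAbove hb)
    exact (Nat.sSup_mem hS.1 hS.2).2
  have hc0 : c ≠ 0 := by
    rintro rfl
    exact hne (by simpa using hc)
  have hcC : (c : ℂ) ≠ 0 := by exact_mod_cast hc0
  rw [hc] at hmem
  obtain ⟨-, hd, ho⟩ := hmem
  have h10 : T 1 0 = star (T 0 1) := (congrFun (congrFun hT.1 1) 0).symm
  have hform : !![1, T 0 1 / (η : ℂ); T 1 0 / η, T 1 1 * T 0 0 / (η : ℂ) ^ 2]
      = normalMatrix (T 0 1 / η) (T 1 1 * T 0 0 / (η : ℂ) ^ 2) := by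
    rw [normalMatrix, star_div₀, star_natCast, h10]
  have hdet : (normalMatrix (T 0 1 / η) (T 1 1 * T 0 0 / (η : ℂ) ^ 2)).det
      = T.det / (η : ℂ) ^ 2 := by
    rw [det_normalMatrix, det_fin_two, h10, star_div₀, star_natCast]
    field_simp
  have hre : (normalMatrix (T 0 1 / η) (T 1 1 * T 0 0 / (η : ℂ) ^ 2)).det.re
      = T.det.re / (η : ℝ) ^ 2 := by
    rw [hdet]
    have : (η : ℂ) ^ 2 = (((η : ℝ) ^ 2 : ℝ) : ℂ) := by push_cast; rfl
    rw [this, Complex.div_ofReal_re]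
  have hmem' : normalMatrix (T 0 1 / η) (T 1 1 * T 0 0 / (η : ℂ) ^ 2) ∈ fourierLattice m := by
    refine normalMatrix_mem_fourierLattice_iff.mpr ⟨?_, ?_⟩
    · obtain ⟨w, hw, h⟩ := ho 0 1 (by decide)
      refine ⟨c * w, mul_mem (by exact_mod_cast intCast_mem_ringInt m c) hw, ?_⟩
      simp only [Matrix.smul_apply, smul_eq_mul] at h
      push_cast at h
      calc T 0 1 / (η : ℂ) = c * (1 / (η * c) * T 0 1) := by field_simp
        _ = (sqrtDisc m)⁻¹ * (c * w) := by rw [h]; ring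
    · obtain ⟨a, ha⟩ := hd 0
      obtain ⟨b, hb⟩ := hd 1
      refine ⟨c ^ 2 * (a * b), ?_⟩
      simp only [Matrix.smul_apply, smul_eq_mul] at ha hb
      push_cast at ha hb ⊢
      rw [← ha, ← hb]
      field_simp
  refine ⟨_, _, hform, hmem', ?_, ?_⟩
  · refine posSemidef_fin_two hmem'.1 (by simp [normalMatrix]) ?_
    rw [hre]
    have := (Complex.nonneg_iff.mp hpos.det_nonneg).1
    positivity
  · rw [natDet, natDet, hre]
    congr 1
    push_cast
    ring

/-- Krieg's function at $D$ is the coefficient at any chosen semidefinite matrix in $\Lambda$ with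
upper left entry $1$ and $-d_{\mathbb{K}}\det=D$, and $0$ if there is none. The choice is harmless
by `fourierCoefficient_normalMatrix_eq_of_det`. -/
theorem mem_kriegSpace_of_extended {m : ℕ} (hm : Squarefree m) {r : ℤ}
    {f : Matrix (Fin 2) (Fin 2) ℂ → ℂ} (hf : f ∈ suganoSpace m r)
    (hext : f ∈ modularForms (extendedGroup m) r) : f ∈ kriegSpace m r := by
  classical
  have hm0 : 0 < m := Nat.pos_of_ne_zero hm.ne_zero
  let Q : ℕ → ℂ × ℂ → Prop := fun D p => normalMatrix p.1 p.2 ∈ fourierLattice m ∧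
    (normalMatrix p.1 p.2).PosSemidef ∧ natDet m (normalMatrix p.1 p.2) 1 = D
  refine ⟨hf.1, fun D => if h : ∃ p, Q D p then
    fourierCoefficient m f (normalMatrix h.choose.1 h.choose.2) else 0, fun T hT hpos hne => ?_⟩
  rw [hf.2 T hT hpos hne]
  refine Finset.sum_congr rfl fun η hη => ?_
  congr 1
  obtain ⟨t, l, hform, hmem, hps, hnat⟩ := sugano_matrix hT hpos hη
  have hex : ∃ p, Q (natDet m T η) p := ⟨(t, l), hmem, hps, hnat⟩
  rw [hform]
  beta_reduce
  rw [dif_pos hex]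
  obtain ⟨h1, h2, h3⟩ := hex.choose_spec
  refine fourierCoefficient_normalMatrix_eq_of_det hm hf hext hmem hps h1 ?_
  have e1 := natDet_eq one_pos hps (by simpa using hmem)
  have e2 := natDet_eq one_pos h2 (by simpa using h1)
  have e3 := e1.symm.trans ((congrArg (Nat.cast (R := ℂ)) (hnat.trans h3.symm)).trans e2)
  have hdisc0 : -(disc m : ℂ) ≠ 0 := by
    rw [neg_disc_eq]
    exact mul_ne_zero (sqrtDisc_ne_zero hm0) (by simpa using sqrtDisc_ne_zero hm0)
  have e4 : -(disc m : ℂ) * (normalMatrix t l).det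
      = -(disc m : ℂ) * (normalMatrix hex.choose.1 hex.choose.2).det := by
    simpa only [Nat.cast_one, one_pow, div_one] using e3
  exact mul_left_cancel₀ hdisc0 e4

/-- Krieg's right-hand side sees only content and determinant, both invariant under conjugation by
admissible matrices; outside the semidefinite cone both coefficients vanish. -/
theorem mem_extended_of_mem_kriegSpace {m : ℕ} (hm : Squarefree m) {r : ℤ}
    {f : Matrix (Fin 2) (Fin 2) ℂ → ℂ} (hf : f ∈ kriegSpace m r) :
    f ∈ modularForms (extendedGroup m) r := by
  have hm0 : 0 < m := Nat.pos_of_ne_zero hm.ne_zero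
  obtain ⟨hmod, a, ha⟩ := hf
  refine (mem_modularForms_extendedGroup_iff hmod).mpr fun A hA => ?_
  have hadm := isAdmissible_of_mem_extensionMatrices hm hA
  refine (hadm.invariant_iff hm0 hmod).mpr fun T hT => ?_
  have hT' := hadm.conj_mem_fourierLattice hm0 hT
  by_cases hpos : T.PosSemidef
  · by_cases h0 : T = 0
    · simp [h0]
    · rw [ha _ hT' (hadm.posSemidef_conj_iff.mpr hpos) (hadm.conj_ne_zero h0), ha T hT hpos h0,
        hadm.content_conj hm0]
      refine Finset.sum_congr rfl fun η _ => ?_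
      rw [natDet, natDet, hadm.det_conj]
  · rw [fourierCoefficient_eq_zero_of_not_posSemidef hm0 hmod hT hpos,
      fourierCoefficient_eq_zero_of_not_posSemidef hm0 hmod hT'
        (fun h => hpos (hadm.posSemidef_conj_iff.mp h))]

end HermitianMaass

end

theorem theorem3 (m : ℕ) (hm : Squarefree m) (r : ℤ) (f : Matrix (Fin 2) (Fin 2) ℂ → ℂ)
    (hf : f ∈ HermitianMaass.suganoSpace m r) :
    f ∈ HermitianMaass.kriegSpace m r ↔
      f ∈ HermitianMaass.modularForms (HermitianMaass.extendedGroup m) r :=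
  ⟨HermitianMaass.mem_extended_of_mem_kriegSpace hm,
    HermitianMaass.mem_kriegSpace_of_extended hm hf⟩
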